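/- Let $k$ be a field, $A$ a finite-dimensional (unital, associative) $k$-algebra, and consider finite-dimensional $(A,A)$-bimodules. For such bimodules $X,Y$ let $\pi_{X,Y}\colon X\otimes_k Y\to X\otimes_A Y$ be the coequalizer of the two maps $X\otimes_k A\otimes_k Y\rightrightarrows X\otimes_k Y$, and write $[x\otimes y]=\pi_{X,Y}(x\otimes y)$. Let $\iota_{X,Y}\colon X\otimes^A Y\hookrightarrow X\otimes_k Y$ be the equalizer inclusion of the subspace $X\otimes^AY=\{\sum_i x_i\otimes y_i : \sum_i x_i.a\otimes y_i=\sum_i x_i\otimes a.y_i \text{ for all } a\in A\}$. Both tensor products, with the left action on the first and the right action on the second factor, make the category of finite-dimensional bimodules monoidal, with units $A$ and $A^*$ and associators $\alpha^{\otimes_A},\alpha^{\otimes^A}$ induced by the associator $\alpha$ of vector spaces. The dual $X^*=\mathrm{Hom}_k(X,k)$ is a bimodule by $(a'.\beta.a)(b)=\beta(a.b.a')$, and $X\cong X^{**}$ denotes the evaluation isomorphism. The internal Homs are $\underline{\mathrm{Hom}}^r(Z,Y)=Y\otimes^A Z^*$ and $\underline{\mathrm{Hom}}^l(Z,Y)=Z^*\otimes^A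 Y$, with adjunctions $\mathrm{Hom}(X\otimes_A Z,Y)\cong\mathrm{Hom}(X,\underline{\mathrm{Hom}}^r(Z,Y))$ and $\mathrm{Hom}(Z\otimes_A X,Y)\cong\mathrm{Hom}(X,\underline{\mathrm{Hom}}^l(Z,Y))$, given by viewing linear maps $Z\to Y$ as elements of $Y\otimes_k Z^*$ and of $Z^*\otimes_k Y$, respectively. For bimodules $X,Y,Z$ define bimodule homomorphisms $$\partial^l,\ \tilde\partial^l\colon X\otimes_A(Y\otimes^A Z)\to(X\otimes_AY)\otimes^A Z,\qquad \partial^r,\ \tilde\partial^r\colon (X\otimes^A Y)\otimes_A Z\to X\otimes^A(Y\otimes_A Z)$$ as follows. * $\gamma^l\colon X\otimes_k(Y\otimes^AZ)\to(X\otimes_kY)\otimes^AZ$ is determined by $\iota_{X\otimes_kY,Z}\circ\gamma^l=\alpha^{-1}\circ(X\otimes_k\iota_{Y,Z})$, and $\partial^l$ by $\partial^l\circ\pi_{X,Y\otimes^AZ}=(\pi_{X,Y}\otimes^AZ)\circ\gamma^l$. * $\tilde\gamma^l\colon X\otimes_A(Y\otimes_kZ)\to(X\otimes_AY)\otimes_kZ$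 is determined by $\tilde\gamma^l\circ\pi_{X,Y\otimes_kZ}=(\pi_{X,Y}\otimes_kZ)\circ\alpha^{-1}$, and $\tilde\partial^l$ by $\iota_{X\otimes_AY,Z}\circ\tilde\partial^l=\tilde\gamma^l\circ(X\otimes_A\iota_{Y,Z})$. * $\gamma^r\colon (X\otimes^AY)\otimes_kZ\to X\otimes^A(Y\otimes_kZ)$ is determined by $\iota_{X,Y\otimes_kZ}\circ\gamma^r=\alpha\circ(\iota_{X,Y}\otimes_kZ)$, and $\partial^r$ by $\partial^r\circ\pi_{X\otimes^AY,Z}=(X\otimes^A\pi_{Y,Z})\circ\gamma^r$. * $\tilde\gamma^r\colon (X\otimes_kY)\otimes_AZ\to X\otimes_k(Y\otimes_AZ)$ is determined by $\tilde\gamma^r\circ\pi_{X\otimes_kY,Z}=(X\otimes_k\pi_{Y,Z})\circ\alpha$, and $\tilde\partial^r$ by $\iota_{X,Y\otimes_AZ}\circ\tilde\partial^r=\tilde\gamma^r\circ(\iota_{X,Y}\otimes_AZ)$. Let ${}^r\delta^Z_{X,Y}\colon X\otimes_A\underline{\mathrm{Hom}}^r(Z,Y)\to\underline{\mathrm{Hom}}^r(Z,X\otimes_AY)$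 be the lax left module functor structure on $\underline{\mathrm{Hom}}^r(Z,-)$ that corresponds under the adjunction to the module functor structure $\alpha^{\otimes_A}$ on $-\otimes_AZ$. Let ${}^l\delta^Z_{X,Y}\colon \underline{\mathrm{Hom}}^l(Z,X)\otimes_AY\to\underline{\mathrm{Hom}}^l(Z,X\otimes_AY)$ be the lax right module functor structure on $\underline{\mathrm{Hom}}^l(Z,-)$ that corresponds under the adjunction to the right module functor structure $(\alpha^{\otimes_A})^{-1}$ on $Z\otimes_A-$. Let ${}^l\hat\delta^Z_{X,Y}\colon (Z^*\otimes^AX)\otimes_AY\to Z^*\otimes^A(X\otimes_AY)$ be the oplax module functor structure on $-\otimes_AY$, over the monoidal category of bimodules with $\otimes^A$, that corresponds under the adjunction to the module functor structure $(\alpha^{\otimes^A})^{-1}$ on the right adjoint $\underline{\mathrm{Hom}}^r(Y,-)=-\otimes^AY^*$. Then for all finite-dimensional $(A,A)$-bimodules $X,Y,Z$, with the identifications $X\cong X^{**}$ and $Z\cong Z^{**}$, $$\partial^r_{X,Y,Z}={}^l\delta^{X^*}_{Y,Z}={}^l\hat\delta^{X^*}_{Y,Z}=\tilde\partial^r_{X,Y,Z}\qquad\text{and}\qquad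 \partial^l_{X,Y,Z}={}^r\delta^{Z^*}_{X,Y}=\tilde\partial^l_{X,Y,Z}.$$ Moreover, for $\sum_i x_i\otimes y_i\in X\otimes^AY$ and $z\in Z$, and for $x\in X$ and $\sum_j y_j\otimes z_j\in Y\otimes^AZ$, $$\partial^r_{X,Y,Z}\Big(\sum_i[(x_i\otimes y_i)\otimes z]\Big)=\sum_i x_i\otimes[y_i\otimes z],\qquad \partial^l_{X,Y,Z}\Big(\sum_j[x\otimes(y_j\otimes z_j)]\Big)=\sum_j[x\otimes y_j]\otimes z_j .$$ -/

import Mathlib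

open CategoryTheory MonoidalCategory TensorProduct MulOpposite

universe u

noncomputable section

/-- A finite-dimensional `(A,A)`-bimodule over the `k`-algebra `A`: a finite-dimensional vector
space with a left action of `A` and a commuting right action of `A` (a left action of `Aᵐᵒᵖ`),
both unital, associative and `k`-linear. -/
structure FDBimod (k A : Type u) [Field k] [Ring A] [Algebra k A] where
  /-- The underlying vector space. -/
  V : Type u
  [addCommGroup : AddCommGroup V]
  [module : Module k V]
  [finite : Module.Finite k V]
  /-- The left action. -/
  lact : A →ₐ[k] Module.End k V
  /-- The right action. -/
  ract : Aᵐᵒᵖ →ₐ[k] Module.End k V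
  comm : ∀ a b v, lact a (ract b v) = ract b (lact a v)

namespace FDBimod

attribute [instance] FDBimod.addCommGroup FDBimod.module FDBimod.finite

section Basic

variable {k A : Type u} [Field k] [Ring A] [Algebra k A]

/-- Bimodule homomorphisms. -/
@[ext]
structure Hom (X Y : FDBimod k A) where
  /-- The underlying linear map. -/
  lin : X.V →ₗ[k] Y.V
  map_l : ∀ a x, lin (X.lact a x) = Y.lact a (lin x)
  map_r : ∀ b x, lin (X.ract b x) = Y.ract b (lin x)

instance : Category (FDBimod k A) where
  Hom X Y := Hom X Y
  id X := ⟨LinearMap.id, fun _ _ => rfl, fun _ _ => rfl⟩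
  comp f g := ⟨g.lin ∘ₗ f.lin, fun a x => by simp [f.map_l, g.map_l],
    fun a x => by simp [f.map_r, g.map_r]⟩

@[simp] theorem id_lin (X : FDBimod k A) : Hom.lin (𝟙 X) = LinearMap.id := rfl

@[simp] theorem comp_lin {X Y Z : FDBimod k A} (f : X ⟶ Y) (g : Y ⟶ Z) :
    Hom.lin (f ≫ g) = Hom.lin g ∘ₗ Hom.lin f := rfl

theorem hom_ext {X Y : FDBimod k A} {f g : X ⟶ Y} (h : ∀ x, Hom.lin f x = Hom.lin g x) : f = g :=
  Hom.ext (LinearMap.ext h)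

/-- An invertible bimodule homomorphism as an isomorphism in the category. -/
def mkIso {X Y : FDBimod k A} (f : X ⟶ Y) (g : Y.V →ₗ[k] X.V)
    (h₁ : ∀ x, g (Hom.lin f x) = x) (h₂ : ∀ y, Hom.lin f (g y) = y) : X ≅ Y where
  hom := f
  inv := ⟨g, fun a y => by rw [← h₁ (X.lact a (g y)), Hom.map_l f, h₂],
    fun a y => by rw [← h₁ (X.ract a (g y)), Hom.map_r f, h₂]⟩
  hom_inv_id := hom_ext h₁
  inv_hom_id := hom_ext h₂

/-- The sub-bimodule of `X` on an invariant subspace `S`. -/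
def sub (X : FDBimod k A) (S : Submodule k X.V) (hl : ∀ a, ∀ x ∈ S, X.lact a x ∈ S)
    (hr : ∀ b, ∀ x ∈ S, X.ract b x ∈ S) : FDBimod k A where
  V := S
  lact :=
    { toFun := fun a => (X.lact a).restrict (hl a)
      map_one' := by ext; simp [LinearMap.restrict_apply]
      map_mul' := fun a b => by ext; simp [LinearMap.restrict_apply]
      map_zero' := by ext; simp [LinearMap.restrict_apply]
      map_add' := fun a b => by ext; simp [LinearMap.restrict_apply]
      commutes' := fun r => by ext; simp [LinearMap.restrict_apply] }
  ract :=
    { toFun := fun a => (X.ract a).restrict (hr a)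
      map_one' := by ext; simp [LinearMap.restrict_apply]
      map_mul' := fun a b => by ext; simp [LinearMap.restrict_apply]
      map_zero' := by ext; simp [LinearMap.restrict_apply]
      map_add' := fun a b => by ext; simp [LinearMap.restrict_apply]
      commutes' := fun r => by
        ext x; exact congrArg (fun f => f x.1) (X.ract.commutes r) }
  comm a b v := Subtype.ext (X.comm a b v)

/-- The quotient bimodule of `X` by an invariant subspace `S`. -/
def quot (X : FDBimod k A) (S : Submodule k X.V) (hl : ∀ a, S ≤ S.comap (X.lact a))
    (hr : ∀ b, S ≤ S.comap (X.ract b)) : FDBimod k A where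
  V := X.V ⧸ S
  lact :=
    { toFun := fun a => S.mapQ S (X.lact a) (hl a)
      map_one' := by ext; simp
      map_mul' := fun a b => by ext; simp
      map_zero' := by ext; simp
      map_add' := fun a b => by ext; simp
      commutes' := fun r => by ext; simp [Algebra.algebraMap_eq_smul_one] }
  ract :=
    { toFun := fun a => S.mapQ S (X.ract a) (hr a)
      map_one' := by ext; simp
      map_mul' := fun a b => by ext; simp
      map_zero' := by ext; simp
      map_add' := fun a b => by ext; simp
      commutes' := fun r => by
        ext x; exact congrArg (fun f => Submodule.Quotient.mk (p := S) (f x)) (X.ract.commutes r) }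
  comm a b v := by
    induction v using Submodule.Quotient.induction_on with
    | H v => exact congrArg (Submodule.Quotient.mk (p := S)) (X.comm a b v)

/-- The linear dual with the bimodule structure `(a'.β.a)(b) = β(a.b.a')`. -/
def dual (X : FDBimod k A) : FDBimod k A where
  V := Module.Dual k X.V
  lact :=
    { toFun := fun a => Module.Dual.transpose (X.ract (op a))
      map_one' := by ext f x; exact congrArg (fun g => f (g x)) (map_one X.ract)
      map_mul' := fun a b => by
        ext f x; exact congrArg (fun g => f (g x)) (map_mul X.ract (op b) (op a))
      map_zero' := by
        ext f x; exact (congrArg (fun g => f (g x)) (map_zero X.ract)).trans (map_zero f)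
      map_add' := fun a b => by
        ext f x
        exact (congrArg (fun g => f (g x)) (map_add X.ract (op a) (op b))).trans (map_add f _ _)
      commutes' := fun r => by
        ext f x
        exact (congrArg (fun g => f (g x)) (X.ract.commutes r)).trans (map_smul f r x) }
  ract :=
    { toFun := fun b => Module.Dual.transpose (X.lact (unop b))
      map_one' := by ext f x; exact congrArg (fun g => f (g x)) (map_one X.lact)
      map_mul' := fun a b => by
        ext f x; exact congrArg (fun g => f (g x)) (map_mul X.lact (unop b) (unop a))
      map_zero' := by
        ext f x; exact (congrArg (fun g => f (g x)) (map_zero X.lact)).trans (map_zero f)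
      map_add' := fun a b => by
        ext f x
        exact (congrArg (fun g => f (g x)) (map_add X.lact (unop a) (unop b))).trans
          (map_add f _ _)
      commutes' := fun r => by
        ext f x
        exact (congrArg (fun g => f (g x)) (X.lact.commutes r)).trans (map_smul f r x) }
  comm a b f := LinearMap.ext fun x => congrArg f (X.comm (unop b) (op a) x)

@[simp] theorem dual_lact_apply (X : FDBimod k A) (a : A) (f : X.V →ₗ[k] k) (x : X.V) :
    DFunLike.coe (F := X.V →ₗ[k] k) (X.dual.lact a f) x = f (X.ract (op a) x) := rfl

@[simp] theorem dual_ract_apply (X : FDBimod k A) (b : Aᵐᵒᵖ) (f : X.V →ₗ[k] k) (x : X.V) :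
    DFunLike.coe (F := X.V →ₗ[k] k) (X.dual.ract b f) x = f (X.lact (unop b) x) := rfl

/-- The canonical isomorphism of a finite-dimensional bimodule with its double dual. -/
def bidual (X : FDBimod k A) : X ≅ X.dual.dual :=
  mkIso ⟨(Module.evalEquiv k X.V).toLinearMap, fun _ _ => rfl, fun _ _ => rfl⟩
    (Module.evalEquiv k X.V).symm.toLinearMap
    (fun x => (Module.evalEquiv k X.V).symm_apply_apply x)
    (fun y => (Module.evalEquiv k X.V).apply_symm_apply y)

/-- The tensor product `X ⊗ₖ Y` over the ground field, with the left action of `A` on `X` and the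
right action of `A` on `Y`. -/
def tensK (X Y : FDBimod k A) : FDBimod k A where
  V := X.V ⊗[k] Y.V
  lact := (Module.End.rTensorAlgHom k X.V Y.V).comp X.lact
  ract := (Module.End.lTensorAlgHom k Y.V X.V).comp Y.ract
  comm a b v := LinearMap.congr_fun
    (f := LinearMap.rTensor Y.V (X.lact a) ∘ₗ LinearMap.lTensor X.V (Y.ract b))
    (g := LinearMap.lTensor X.V (Y.ract b) ∘ₗ LinearMap.rTensor Y.V (X.lact a))
    (by ext; simp) v

theorem tensK_lact (X Y : FDBimod k A) (a : A) :
    (tensK X Y).lact a = LinearMap.rTensor Y.V (X.lact a) := rfl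

theorem tensK_ract (X Y : FDBimod k A) (b : Aᵐᵒᵖ) :
    (tensK X Y).ract b = LinearMap.lTensor X.V (Y.ract b) := rfl

/-- Functoriality of `⊗ₖ`. -/
def mapK {X X' Y Y' : FDBimod k A} (f : X ⟶ X') (g : Y ⟶ Y') : tensK X Y ⟶ tensK X' Y' where
  lin := TensorProduct.map f.lin g.lin
  map_l a t := LinearMap.congr_fun
    (f := TensorProduct.map f.lin g.lin ∘ₗ LinearMap.rTensor Y.V (X.lact a))
    (g := LinearMap.rTensor Y'.V (X'.lact a) ∘ₗ TensorProduct.map f.lin g.lin)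
    (by ext; simp [f.map_l]) t
  map_r b t := LinearMap.congr_fun
    (f := TensorProduct.map f.lin g.lin ∘ₗ LinearMap.lTensor X.V (Y.ract b))
    (g := LinearMap.lTensor X'.V (Y'.ract b) ∘ₗ TensorProduct.map f.lin g.lin)
    (by ext; simp [g.map_r]) t

/-- The associator of vector spaces, `(X ⊗ₖ Y) ⊗ₖ Z ≅ X ⊗ₖ (Y ⊗ₖ Z)`. -/
def assocK (X Y Z : FDBimod k A) : tensK (tensK X Y) Z ≅ tensK X (tensK Y Z) :=
  mkIso
    { lin := (TensorProduct.assoc k X.V Y.V Z.V).toLinearMap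
      map_l := fun a t => LinearMap.congr_fun (f := (TensorProduct.assoc k X.V Y.V Z.V).toLinearMap
        ∘ₗ LinearMap.rTensor Z.V (LinearMap.rTensor Y.V (X.lact a)))
        (g := LinearMap.rTensor (Y.V ⊗[k] Z.V) (X.lact a) ∘ₗ
          (TensorProduct.assoc k X.V Y.V Z.V).toLinearMap) (by ext; simp) t
      map_r := fun b t => LinearMap.congr_fun (f := (TensorProduct.assoc k X.V Y.V Z.V).toLinearMap
        ∘ₗ LinearMap.lTensor (X.V ⊗[k] Y.V) (Z.ract b))
        (g := LinearMap.lTensor X.V (LinearMap.lTensor Y.V (Z.ract b)) ∘ₗ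
          (TensorProduct.assoc k X.V Y.V Z.V).toLinearMap) (by ext; simp) t }
    (TensorProduct.assoc k X.V Y.V Z.V).symm.toLinearMap
    (fun x => (TensorProduct.assoc k X.V Y.V Z.V).symm_apply_apply x)
    (fun y => (TensorProduct.assoc k X.V Y.V Z.V).apply_symm_apply y)

/-! ### The tensor product over `A` as a coequalizer -/

/-- The subspace of `X ⊗ₖ Y` spanned by all `x.a ⊗ y - x ⊗ a.y`. -/
def bal (X Y : FDBimod k A) : Submodule k (X.V ⊗[k] Y.V) :=
  Submodule.span k {t | ∃ x a y, t = X.ract (op a) x ⊗ₜ[k] y - x ⊗ₜ[k] Y.lact a y}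

/-- The tensor product `X ⊗_A Y`. -/
def tensA (X Y : FDBimod k A) : FDBimod k A :=
  quot (tensK X Y) (bal X Y)
    (fun a => Submodule.span_le.2 (by
      rintro _ ⟨x, c, y, rfl⟩
      refine Submodule.subset_span ⟨X.lact a x, c, y, ?_⟩
      refine (map_sub (LinearMap.rTensor Y.V (X.lact a)) _ _).trans ?_
      rw [LinearMap.rTensor_tmul, LinearMap.rTensor_tmul, X.comm]))
    (fun b => Submodule.span_le.2 (by
      rintro _ ⟨x, c, y, rfl⟩
      refine Submodule.subset_span ⟨x, c, Y.ract b y, ?_⟩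
      refine (map_sub (LinearMap.lTensor X.V (Y.ract b)) _ _).trans ?_
      rw [LinearMap.lTensor_tmul, LinearMap.lTensor_tmul, Y.comm]))

/-- The coequalizer surjection `π : X ⊗ₖ Y ⟶ X ⊗_A Y`. -/
def π (X Y : FDBimod k A) : tensK X Y ⟶ tensA X Y where
  lin := (bal X Y).mkQ
  map_l _ _ := rfl
  map_r _ _ := rfl

/-- The class `[x ⊗ y]` in `X ⊗_A Y`. -/
def tmulA {X Y : FDBimod k A} (x : X.V) (y : Y.V) : (tensA X Y).V :=
  Hom.lin (π X Y) (x ⊗ₜ[k] y)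

theorem tmulA_bal {X Y : FDBimod k A} (x : X.V) (a : A) (y : Y.V) :
    tmulA (X.ract (op a) x) y = tmulA x (Y.lact a y) :=
  (Submodule.Quotient.eq _).2 (Submodule.subset_span ⟨x, a, y, rfl⟩)

/-- `[x ⊗ y]` as a bilinear map. -/
def mkA (X Y : FDBimod k A) : X.V →ₗ[k] Y.V →ₗ[k] (tensA X Y).V :=
  (TensorProduct.mk k X.V Y.V).compr₂ (Hom.lin (π X Y))

@[simp] theorem mkA_apply {X Y : FDBimod k A} (x : X.V) (y : Y.V) :
    mkA X Y x y = tmulA x y := rfl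

@[simp] theorem π_tmul {X Y : FDBimod k A} (x : X.V) (y : Y.V) :
    Hom.lin (π X Y) (x ⊗ₜ[k] y) = tmulA x y := rfl

theorem tmulA_add {X Y : FDBimod k A} (x : X.V) (y y' : Y.V) :
    tmulA x (y + y') = tmulA x y + tmulA x y' := map_add (mkA X Y x) y y'

theorem add_tmulA {X Y : FDBimod k A} (x x' : X.V) (y : Y.V) :
    tmulA (x + x') y = tmulA x y + tmulA x' y := LinearMap.map_add₂ (mkA X Y) x x' y

theorem tmulA_smul {X Y : FDBimod k A} (c : k) (x : X.V) (y : Y.V) :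
    tmulA x (c • y) = c • tmulA x y := map_smul (mkA X Y x) c y

theorem smul_tmulA {X Y : FDBimod k A} (c : k) (x : X.V) (y : Y.V) :
    tmulA (c • x) y = c • tmulA x y := LinearMap.map_smul₂ (mkA X Y) c x y

@[simp] theorem tensA_lact_tmulA {X Y : FDBimod k A} (a : A) (x : X.V) (y : Y.V) :
    (tensA X Y).lact a (tmulA x y) = tmulA (X.lact a x) y := rfl

@[simp] theorem tensA_ract_tmulA {X Y : FDBimod k A} (b : Aᵐᵒᵖ) (x : X.V) (y : Y.V) :
    (tensA X Y).ract b (tmulA x y) = tmulA x (Y.ract b y) := rfl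

theorem tensA_induction {X Y : FDBimod k A} {P : (tensA X Y).V → Prop}
    (h : ∀ x y, P (tmulA x y)) (hadd : ∀ s t, P s → P t → P (s + t)) (t) : P t := by
  obtain ⟨t, rfl⟩ := Submodule.mkQ_surjective (bal X Y) t
  induction t using TensorProduct.induction_on with
  | zero =>
    have := h 0 0
    rwa [← mkA_apply, map_zero] at this
  | tmul x y => exact h x y
  | add s t hs ht => rw [map_add]; exact hadd _ _ hs ht

/-- The linear map out of `X ⊗_A Y` induced by a balanced bilinear map. -/
def liftA {X Y : FDBimod k A} {W : Type u} [AddCommGroup W] [Module k W]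
    (f : X.V →ₗ[k] Y.V →ₗ[k] W)
    (hf : ∀ x a y, f (X.ract (op a) x) y = f x (Y.lact a y)) : (tensA X Y).V →ₗ[k] W :=
  (bal X Y).liftQ (TensorProduct.lift f) (Submodule.span_le.2 (by
    rintro _ ⟨x, a, y, rfl⟩
    simp [hf]))

@[simp] theorem liftA_tmulA {X Y : FDBimod k A} {W : Type u} [AddCommGroup W] [Module k W]
    (f : X.V →ₗ[k] Y.V →ₗ[k] W) (hf) (x : X.V) (y : Y.V) :
    liftA f hf (tmulA x y) = f x y := TensorProduct.lift.tmul x y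

/-- The universal property of the coequalizer: the bimodule homomorphism out of `X ⊗_A Y` induced
by a balanced homomorphism out of `X ⊗ₖ Y`. -/
def descA {X Y W : FDBimod k A} (f : tensK X Y ⟶ W)
    (hf : ∀ x a y, f.lin (X.ract (op a) x ⊗ₜ[k] y) = f.lin (x ⊗ₜ[k] Y.lact a y)) :
    tensA X Y ⟶ W where
  lin := (bal X Y).liftQ f.lin (Submodule.span_le.2 (by
    rintro _ ⟨x, a, y, rfl⟩
    exact (map_sub f.lin _ _).trans (sub_eq_zero.2 (hf x a y))))
  map_l a t := by
    obtain ⟨t, rfl⟩ := Submodule.mkQ_surjective (bal X Y) t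
    exact f.map_l a t
  map_r a t := by
    obtain ⟨t, rfl⟩ := Submodule.mkQ_surjective (bal X Y) t
    exact f.map_r a t

theorem π_descA {X Y W : FDBimod k A} (f : tensK X Y ⟶ W) (hf) :
    π X Y ≫ descA f hf = f := rfl

@[simp] theorem descA_tmulA {X Y W : FDBimod k A} (f : tensK X Y ⟶ W) (hf) (x : X.V) (y : Y.V) :
    Hom.lin (descA f hf) (tmulA x y) = f.lin (x ⊗ₜ[k] y) := rfl

theorem tensA_hom_ext {X Y W : FDBimod k A} {f g : tensA X Y ⟶ W}
    (h : ∀ x y, Hom.lin f (tmulA x y) = Hom.lin g (tmulA x y)) : f = g :=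
  hom_ext fun t => tensA_induction (P := fun t => Hom.lin f t = Hom.lin g t) h
    (fun s t hs ht => by rw [map_add, map_add, hs, ht]) t

theorem tensA_ext₂ {X Y : FDBimod k A} {W : Type u} [AddCommGroup W] [Module k W]
    {f g : (tensA X Y).V →ₗ[k] W} (h : ∀ x y, f (tmulA x y) = g (tmulA x y)) : f = g :=
  LinearMap.ext fun t => tensA_induction (P := fun t => f t = g t) h
    (fun s t hs ht => by rw [map_add, map_add, hs, ht]) t

/-- Functoriality of `⊗_A`. -/
def mapA {X X' Y Y' : FDBimod k A} (f : X ⟶ X') (g : Y ⟶ Y') : tensA X Y ⟶ tensA X' Y' :=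
  descA (mapK f g ≫ π X' Y') (fun x a y => by
    change tmulA (f.lin _) (g.lin _) = tmulA (f.lin _) (g.lin _)
    rw [f.map_r, g.map_l, tmulA_bal])

@[simp] theorem mapA_tmulA {X X' Y Y' : FDBimod k A} (f : X ⟶ X') (g : Y ⟶ Y') (x : X.V)
    (y : Y.V) : Hom.lin (mapA f g) (tmulA x y) = tmulA (Hom.lin f x) (Hom.lin g y) := rfl

/-! ### The tensor product `⊗^A` as an equalizer -/

/-- The subspace of all `∑ yᵢ ⊗ zᵢ` in `Y ⊗ₖ Z` with `∑ yᵢ.a ⊗ zᵢ = ∑ yᵢ ⊗ a.zᵢ` for all `a`. -/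
def cobal (Y Z : FDBimod k A) : Submodule k (Y.V ⊗[k] Z.V) where
  carrier := {t | ∀ a : A, LinearMap.rTensor Z.V (Y.ract (op a)) t =
    LinearMap.lTensor Y.V (Z.lact a) t}
  add_mem' hs ht a := by rw [map_add, map_add, hs a, ht a]
  zero_mem' a := by rw [map_zero, map_zero]
  smul_mem' c t ht a := by rw [map_smul, map_smul, ht a]

theorem mem_cobal {Y Z : FDBimod k A} {t : Y.V ⊗[k] Z.V} :
    t ∈ cobal Y Z ↔ ∀ a : A, LinearMap.rTensor Z.V (Y.ract (op a)) t =
      LinearMap.lTensor Y.V (Z.lact a) t := Iff.rfl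

/-- The tensor product `Y ⊗^A Z`. -/
def cotens (Y Z : FDBimod k A) : FDBimod k A :=
  sub (tensK Y Z) (cobal Y Z)
    (fun a t ht c => by
      rw [tensK_lact]
      have h₁ := LinearMap.congr_fun (f := LinearMap.rTensor Z.V (Y.ract (op c)) ∘ₗ
        LinearMap.rTensor Z.V (Y.lact a)) (g := LinearMap.rTensor Z.V (Y.lact a) ∘ₗ
        LinearMap.rTensor Z.V (Y.ract (op c))) (by ext; simp [Y.comm]) t
      have h₂ := LinearMap.congr_fun (f := LinearMap.lTensor Y.V (Z.lact c) ∘ₗ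
        LinearMap.rTensor Z.V (Y.lact a)) (g := LinearMap.rTensor Z.V (Y.lact a) ∘ₗ
        LinearMap.lTensor Y.V (Z.lact c)) (by ext; simp) t
      exact h₁.trans ((congrArg _ (ht c)).trans h₂.symm))
    (fun b t ht c => by
      rw [tensK_ract]
      have h₁ := LinearMap.congr_fun (f := LinearMap.rTensor Z.V (Y.ract (op c)) ∘ₗ
        LinearMap.lTensor Y.V (Z.ract b)) (g := LinearMap.lTensor Y.V (Z.ract b) ∘ₗ
        LinearMap.rTensor Z.V (Y.ract (op c))) (by ext; simp) t
      have h₂ := LinearMap.congr_fun (f := LinearMap.lTensor Y.V (Z.lact c) ∘ₗ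
        LinearMap.lTensor Y.V (Z.ract b)) (g := LinearMap.lTensor Y.V (Z.ract b) ∘ₗ
        LinearMap.lTensor Y.V (Z.lact c)) (by ext; simp [Z.comm]) t
      exact h₁.trans ((congrArg _ (ht c)).trans h₂.symm))

/-- The equalizer inclusion `ι : Y ⊗^A Z ⟶ Y ⊗ₖ Z`. -/
def ι (Y Z : FDBimod k A) : cotens Y Z ⟶ tensK Y Z where
  lin := (cobal Y Z).subtype
  map_l _ _ := rfl
  map_r _ _ := rfl

theorem ι_injective (Y Z : FDBimod k A) : Function.Injective (Hom.lin (ι Y Z)) :=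
  Subtype.val_injective

theorem ι_mem {Y Z : FDBimod k A} (t : (cotens Y Z).V) : Hom.lin (ι Y Z) t ∈ cobal Y Z := t.2

/-- The universal property of the equalizer: the bimodule homomorphism into `Y ⊗^A Z` induced
by a cobalanced homomorphism into `Y ⊗ₖ Z`. -/
def liftC {W Y Z : FDBimod k A} (f : W ⟶ tensK Y Z) (hf : ∀ w, Hom.lin f w ∈ cobal Y Z) :
    W ⟶ cotens Y Z where
  lin := LinearMap.codRestrict (cobal Y Z) f.lin hf
  map_l a w := Subtype.ext (f.map_l a w)
  map_r a w := Subtype.ext (f.map_r a w)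

theorem liftC_ι {W Y Z : FDBimod k A} (f : W ⟶ tensK Y Z) (hf) :
    liftC f hf ≫ ι Y Z = f := rfl

@[simp] theorem ι_liftC {W Y Z : FDBimod k A} (f : W ⟶ tensK Y Z) (hf) (w : W.V) :
    Hom.lin (ι Y Z) (Hom.lin (liftC f hf) w) = Hom.lin f w := rfl

theorem cotens_hom_ext {W Y Z : FDBimod k A} {f g : W ⟶ cotens Y Z}
    (h : f ≫ ι Y Z = g ≫ ι Y Z) : f = g :=
  hom_ext fun w => ι_injective Y Z (LinearMap.congr_fun (congrArg Hom.lin h) w)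

theorem mapK_mem_cobal {Y Y' Z Z' : FDBimod k A} (f : Y ⟶ Y') (g : Z ⟶ Z')
    {t : Y.V ⊗[k] Z.V} (ht : t ∈ cobal Y Z) :
    TensorProduct.map f.lin g.lin t ∈ cobal Y' Z' := by
  intro a
  have h₁ := LinearMap.congr_fun (f := LinearMap.rTensor Z'.V (Y'.ract (op a)) ∘ₗ
    TensorProduct.map f.lin g.lin) (g := TensorProduct.map f.lin g.lin ∘ₗ
    LinearMap.rTensor Z.V (Y.ract (op a))) (by ext; simp [f.map_r]) t
  have h₂ := LinearMap.congr_fun (f := LinearMap.lTensor Y'.V (Z'.lact a) ∘ₗ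
    TensorProduct.map f.lin g.lin) (g := TensorProduct.map f.lin g.lin ∘ₗ
    LinearMap.lTensor Y.V (Z.lact a)) (by ext; simp [g.map_l]) t
  exact h₁.trans ((congrArg _ (ht a)).trans h₂.symm)

/-- Functoriality of `⊗^A`. -/
def mapC {Y Y' Z Z' : FDBimod k A} (f : Y ⟶ Y') (g : Z ⟶ Z') : cotens Y Z ⟶ cotens Y' Z' :=
  liftC (ι Y Z ≫ mapK f g) (fun t => mapK_mem_cobal f g t.2)

theorem mapC_ι {Y Y' Z Z' : FDBimod k A} (f : Y ⟶ Y') (g : Z ⟶ Z') :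
    mapC f g ≫ ι Y' Z' = ι Y Z ≫ mapK f g := rfl

end Basic

section Monoidal

variable {k A : Type u} [Field k] [Ring A] [Algebra k A]

/-- The linear map `(X ⊗_A Y) ⊗_A Z → X ⊗_A (Y ⊗_A Z)`. -/
def assocAux (X Y Z : FDBimod k A) :
    (tensA (tensA X Y) Z).V →ₗ[k] (tensA X (tensA Y Z)).V :=
  liftA (liftA
      { toFun := fun x => (mkA Y Z).compr₂ (mkA X (tensA Y Z) x)
        map_add' := fun x x' => by ext; simp
        map_smul' := fun c x => by ext; simp }
      (fun x a y => LinearMap.ext fun z => tmulA_bal x a (tmulA y z)))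
    (fun p a z => by
      induction p using tensA_induction with
      | h x y => exact congrArg (tmulA x) (tmulA_bal y a z)
      | hadd s t hs ht => simp only [map_add, LinearMap.add_apply, hs, ht])

/-- The linear map `X ⊗_A (Y ⊗_A Z) → (X ⊗_A Y) ⊗_A Z`. -/
def assocInvAux (X Y Z : FDBimod k A) :
    (tensA X (tensA Y Z)).V →ₗ[k] (tensA (tensA X Y) Z).V :=
  liftA
    { toFun := fun x => liftA (X := Y) (Y := Z) ((mkA (tensA X Y) Z) ∘ₗ (mkA X Y x))
        (fun y a z => tmulA_bal (tmulA x y) a z)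
      map_add' := fun x x' => tensA_ext₂ fun y z => by
        change tmulA (tmulA (x + x') y) z = tmulA (tmulA x y) z + tmulA (tmulA x' y) z
        rw [add_tmulA, add_tmulA]
      map_smul' := fun c x => tensA_ext₂ fun y z => by
        change tmulA (tmulA (c • x) y) z = c • tmulA (tmulA x y) z
        rw [smul_tmulA, smul_tmulA] }
    (fun x a p => by
      induction p using tensA_induction with
      | h y z => exact congrArg (fun q => tmulA q z) (tmulA_bal x a y)
      | hadd s t hs ht => simp only [map_add, hs, ht])

theorem tensA_ext₃ {X Y Z : FDBimod k A} {W : Type u} [AddCommGroup W] [Module k W]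
    {f g : (tensA (tensA X Y) Z).V →ₗ[k] W}
    (h : ∀ x y z, f (tmulA (tmulA x y) z) = g (tmulA (tmulA x y) z)) (t) : f t = g t := by
  induction t using tensA_induction with
  | h p z =>
    induction p using tensA_induction with
    | h x y => exact h x y z
    | hadd s t hs ht => rw [add_tmulA, map_add, map_add, hs, ht]
  | hadd s t hs ht => rw [map_add, map_add, hs, ht]

theorem tensA_ext₃' {X Y Z : FDBimod k A} {W : Type u} [AddCommGroup W] [Module k W]
    {f g : (tensA X (tensA Y Z)).V →ₗ[k] W}
    (h : ∀ x y z, f (tmulA x (tmulA y z)) = g (tmulA x (tmulA y z))) (t) : f t = g t := by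
  induction t using tensA_induction with
  | h x p =>
    induction p using tensA_induction with
    | h y z => exact h x y z
    | hadd s t hs ht => rw [tmulA_add, map_add, map_add, hs, ht]
  | hadd s t hs ht => rw [map_add, map_add, hs, ht]

/-- The associator of `⊗_A`. -/
def assocA (X Y Z : FDBimod k A) : tensA (tensA X Y) Z ≅ tensA X (tensA Y Z) :=
  mkIso
    { lin := assocAux X Y Z
      map_l := fun a => tensA_ext₃ (f := assocAux X Y Z ∘ₗ (tensA (tensA X Y) Z).lact a)
        (g := (tensA X (tensA Y Z)).lact a ∘ₗ assocAux X Y Z) (fun _ _ _ => rfl)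
      map_r := fun a => tensA_ext₃ (f := assocAux X Y Z ∘ₗ (tensA (tensA X Y) Z).ract a)
        (g := (tensA X (tensA Y Z)).ract a ∘ₗ assocAux X Y Z) (fun _ _ _ => rfl) }
    (assocInvAux X Y Z)
    (tensA_ext₃ (f := assocInvAux X Y Z ∘ₗ assocAux X Y Z) (g := LinearMap.id) (fun _ _ _ => rfl))
    (tensA_ext₃' (f := assocAux X Y Z ∘ₗ assocInvAux X Y Z) (g := LinearMap.id) (fun _ _ _ => rfl))

theorem assocA_hom_tmulA {X Y Z : FDBimod k A} (x : X.V) (y : Y.V) (z : Z.V) :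
    Hom.lin (assocA X Y Z).hom (tmulA (tmulA x y) z) = tmulA x (tmulA y z) := rfl

theorem assocA_inv_tmulA {X Y Z : FDBimod k A} (x : X.V) (y : Y.V) (z : Z.V) :
    Hom.lin (assocA X Y Z).inv (tmulA x (tmulA y z)) = tmulA (tmulA x y) z := rfl

variable [Module.Finite k A]

variable (k A) in
/-- The regular bimodule `A`. -/
def regular : FDBimod k A where
  V := A
  lact := Algebra.lmul k A
  ract :=
    { toFun := fun b => LinearMap.mulRight k (unop b)
      map_one' := by ext; simp
      map_mul' := fun a b => by ext x; simp [mul_assoc]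
      map_zero' := by ext; simp
      map_add' := fun a b => by ext; simp [mul_add]
      commutes' := fun r => by
        ext x
        simp [Algebra.algebraMap_eq_smul_one] }
  comm a b x := (mul_assoc a x (unop b)).symm

@[simp] theorem regular_lact (a : A) (x : A) : (regular k A).lact a x = a * x := rfl

@[simp] theorem regular_ract (b : Aᵐᵒᵖ) (x : A) : (regular k A).ract b x = x * unop b := rfl

/-- The left unitor of `⊗_A`. -/
def lunitA (X : FDBimod k A) : tensA (regular k A) X ≅ X :=
  mkIso
    (descA
      { lin := TensorProduct.lift X.lact.toLinearMap
        map_l := fun a t => LinearMap.congr_fun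
          (f := TensorProduct.lift X.lact.toLinearMap ∘ₗ
            LinearMap.rTensor X.V (Algebra.lmul k A a))
          (g := X.lact a ∘ₗ TensorProduct.lift X.lact.toLinearMap)
          (TensorProduct.ext' fun b x => congrArg (fun f => f x) (map_mul X.lact a b)) t
        map_r := fun b t => LinearMap.congr_fun
          (f := TensorProduct.lift X.lact.toLinearMap ∘ₗ
            LinearMap.lTensor A (X.ract b))
          (g := X.ract b ∘ₗ TensorProduct.lift X.lact.toLinearMap)
          (TensorProduct.ext' fun a x => X.comm a b x) t }
      (fun (c : A) a x => congrArg (fun f => f x) (map_mul X.lact (c : A) a)))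
    (mkA (regular k A) X (1 : A))
    (fun t => LinearMap.congr_fun (f := mkA (regular k A) X (1 : A) ∘ₗ _) (g := LinearMap.id)
      (LinearMap.ext fun t => by
        induction t using tensA_induction with
        | h c x =>
          exact (tmulA_bal (X := regular k A) (1 : A) c x).symm.trans
            (congrArg (fun d => tmulA (X := regular k A) d x) (one_mul (M := A) c))
        | hadd s t hs ht => rw [map_add, map_add, hs, ht]) t)
    (fun x => congrArg (fun f => f x) (map_one X.lact))

theorem lunitA_tmulA {X : FDBimod k A} (a : A) (x : X.V) :
    Hom.lin (lunitA X).hom (tmulA (X := regular k A) a x) = X.lact a x := rfl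

/-- The right unitor of `⊗_A`. -/
def runitA (X : FDBimod k A) : tensA X (regular k A) ≅ X :=
  mkIso
    (descA
      { lin := TensorProduct.lift
          (X.ract.toLinearMap ∘ₗ (MulOpposite.opLinearEquiv k).toLinearMap).flip
        map_l := fun a t => LinearMap.congr_fun
          (f := TensorProduct.lift
            (X.ract.toLinearMap ∘ₗ (MulOpposite.opLinearEquiv k).toLinearMap).flip ∘ₗ
            LinearMap.rTensor A (X.lact a))
          (g := X.lact a ∘ₗ TensorProduct.lift
            (X.ract.toLinearMap ∘ₗ (MulOpposite.opLinearEquiv k).toLinearMap).flip)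
          (TensorProduct.ext' fun x b => (X.comm a (op b) x).symm) t
        map_r := fun b t => LinearMap.congr_fun
          (f := TensorProduct.lift
            (X.ract.toLinearMap ∘ₗ (MulOpposite.opLinearEquiv k).toLinearMap).flip ∘ₗ
            LinearMap.lTensor X.V (LinearMap.mulRight k (unop b)))
          (g := X.ract b ∘ₗ TensorProduct.lift
            (X.ract.toLinearMap ∘ₗ (MulOpposite.opLinearEquiv k).toLinearMap).flip)
          (TensorProduct.ext' fun x c => congrArg (fun f => f x) (map_mul X.ract b (op c))) t }
      (fun x a (c : A) => (congrArg (fun f => f x) (map_mul X.ract (op (c : A)) (op a))).symm))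
    ((mkA X (regular k A)).flip (1 : A))
    (fun t => LinearMap.congr_fun (f := (mkA X (regular k A)).flip (1 : A) ∘ₗ _)
      (g := LinearMap.id)
      (LinearMap.ext fun t => by
        induction t using tensA_induction with
        | h x c =>
          exact (tmulA_bal (Y := regular k A) x c (1 : A)).trans
            (congrArg (fun d => tmulA (Y := regular k A) x d) (mul_one (M := A) c))
        | hadd s t hs ht => rw [map_add, map_add, hs, ht]) t)
    (fun x => congrArg (fun f => f x) (map_one X.ract))

theorem runitA_tmulA {X : FDBimod k A} (x : X.V) (a : A) :
    Hom.lin (runitA X).hom (tmulA (Y := regular k A) x a) = X.ract (op a) x := rfl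

instance : MonoidalCategoryStruct (FDBimod k A) where
  tensorObj := tensA
  tensorHom := mapA
  whiskerLeft X _ _ g := mapA (𝟙 X) g
  whiskerRight f Y := mapA f (𝟙 Y)
  tensorUnit := regular k A
  associator := assocA
  leftUnitor := lunitA
  rightUnitor := runitA

/-- The monoidal category of finite-dimensional bimodules with `⊗_A` as tensor product. -/
instance : MonoidalCategory (FDBimod k A) :=
  MonoidalCategory.ofTensorHom
    (id_tensorHom_id := fun _ _ => tensA_hom_ext fun _ _ => rfl)
    (id_tensorHom := fun _ _ _ _ => rfl)
    (tensorHom_id := fun _ _ => rfl)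
    (tensorHom_comp_tensorHom := fun _ _ _ _ => tensA_hom_ext fun _ _ => rfl)
    (associator_naturality := fun _ _ _ => hom_ext (tensA_ext₃ fun _ _ _ => rfl))
    (leftUnitor_naturality := fun f => tensA_hom_ext fun a x => (Hom.map_l f a x).symm)
    (rightUnitor_naturality := fun f => tensA_hom_ext fun x a => (Hom.map_r f (op a) x).symm)
    (pentagon := fun W X Y Z => tensA_hom_ext fun t z => by
      induction t using tensA_induction with
      | h p y =>
        induction p using tensA_induction with
        | h w x => rfl
        | hadd s t hs ht => rw [add_tmulA, add_tmulA, map_add, map_add, hs, ht]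
      | hadd s t hs ht => rw [add_tmulA, map_add, map_add, hs, ht])
    (triangle := fun X Y => hom_ext (tensA_ext₃ fun x a y => (tmulA_bal x a y).symm))

end Monoidal

section InternalHom

variable {k A : Type u} [Field k] [Ring A] [Algebra k A]

/-- The canonical isomorphism `Z^* ⊗ₖ Y ≅ Hom_k(Z, Y)`, `f ⊗ y ↦ f(-) y`. -/
def evL (Z Y : FDBimod k A) : (tensK Z.dual Y).V ≃ₗ[k] (Z.V →ₗ[k] Y.V) :=
  dualTensorHomEquiv k Z.V Y.V

/-- The canonical isomorphism `Y ⊗ₖ Z^* ≅ Hom_k(Z, Y)`, `y ⊗ f ↦ f(-) y`. -/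
def evR (Z Y : FDBimod k A) : (tensK Y Z.dual).V ≃ₗ[k] (Z.V →ₗ[k] Y.V) :=
  (TensorProduct.comm k Y.V (Module.Dual k Z.V)).trans (dualTensorHomEquiv k Z.V Y.V)

theorem evL_tmul {Z Y : FDBimod k A} (f : Module.Dual k Z.V) (y : Y.V) (z : Z.V) :
    evL Z Y (f ⊗ₜ[k] y) z = f z • y := rfl

theorem evR_tmul {Z Y : FDBimod k A} (f : Module.Dual k Z.V) (y : Y.V) (z : Z.V) :
    evR Z Y (y ⊗ₜ[k] f) z = f z • y := rfl

theorem evL_lact {Z Y : FDBimod k A} (a : A) (t : (tensK Z.dual Y).V) :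
    evL Z Y ((tensK Z.dual Y).lact a t) = evL Z Y t ∘ₗ Z.ract (op a) :=
  LinearMap.congr_fun (f := (evL Z Y).toLinearMap ∘ₗ (tensK Z.dual Y).lact a)
    (g := (LinearMap.lcomp k Y.V (Z.ract (op a))) ∘ₗ (evL Z Y).toLinearMap)
    (TensorProduct.ext' fun _ _ => rfl) t

theorem evL_ract {Z Y : FDBimod k A} (b : Aᵐᵒᵖ) (t : (tensK Z.dual Y).V) :
    evL Z Y ((tensK Z.dual Y).ract b t) = Y.ract b ∘ₗ evL Z Y t :=
  LinearMap.congr_fun (f := (evL Z Y).toLinearMap ∘ₗ (tensK Z.dual Y).ract b)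
    (g := (LinearMap.llcomp k Z.V Y.V Y.V (Y.ract b)) ∘ₗ (evL Z Y).toLinearMap)
    (TensorProduct.ext' fun (f : Module.Dual k Z.V) y => LinearMap.ext fun z =>
      (map_smul (Y.ract b) (f z) y).symm) t

theorem evL_map {Z Y Y' : FDBimod k A} (g : Y ⟶ Y') (t : (tensK Z.dual Y).V) :
    evL Z Y' (Hom.lin (mapK (𝟙 Z.dual) g) t) = Hom.lin g ∘ₗ evL Z Y t :=
  LinearMap.congr_fun (f := (evL Z Y').toLinearMap ∘ₗ Hom.lin (mapK (𝟙 Z.dual) g))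
    (g := (LinearMap.llcomp k Z.V Y.V Y'.V (Hom.lin g)) ∘ₗ (evL Z Y).toLinearMap)
    (TensorProduct.ext' fun (f : Module.Dual k Z.V) y => LinearMap.ext fun z =>
      (map_smul (Hom.lin g) (f z) y).symm) t

theorem evR_lact {Z Y : FDBimod k A} (a : A) (t : (tensK Y Z.dual).V) :
    evR Z Y ((tensK Y Z.dual).lact a t) = Y.lact a ∘ₗ evR Z Y t :=
  LinearMap.congr_fun (f := (evR Z Y).toLinearMap ∘ₗ (tensK Y Z.dual).lact a)
    (g := (LinearMap.llcomp k Z.V Y.V Y.V (Y.lact a)) ∘ₗ (evR Z Y).toLinearMap)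
    (TensorProduct.ext' fun y (f : Module.Dual k Z.V) => LinearMap.ext fun z =>
      (map_smul (Y.lact a) (f z) y).symm) t

theorem evR_ract {Z Y : FDBimod k A} (b : Aᵐᵒᵖ) (t : (tensK Y Z.dual).V) :
    evR Z Y ((tensK Y Z.dual).ract b t) = evR Z Y t ∘ₗ Z.lact (unop b) :=
  LinearMap.congr_fun (f := (evR Z Y).toLinearMap ∘ₗ (tensK Y Z.dual).ract b)
    (g := (LinearMap.lcomp k Y.V (Z.lact (unop b))) ∘ₗ (evR Z Y).toLinearMap)
    (TensorProduct.ext' fun _ _ => rfl) t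

theorem evR_map {Z Y Y' : FDBimod k A} (g : Y ⟶ Y') (t : (tensK Y Z.dual).V) :
    evR Z Y' (Hom.lin (mapK g (𝟙 Z.dual)) t) = Hom.lin g ∘ₗ evR Z Y t :=
  LinearMap.congr_fun (f := (evR Z Y').toLinearMap ∘ₗ Hom.lin (mapK g (𝟙 Z.dual)))
    (g := (LinearMap.llcomp k Z.V Y.V Y'.V (Hom.lin g)) ∘ₗ (evR Z Y).toLinearMap)
    (TensorProduct.ext' fun y (f : Module.Dual k Z.V) => LinearMap.ext fun z =>
      (map_smul (Hom.lin g) (f z) y).symm) t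

theorem mem_cobal_left {Z Y : FDBimod k A} {t : (tensK Z.dual Y).V} :
    t ∈ cobal Z.dual Y ↔ ∀ a z, evL Z Y t (Z.lact a z) = Y.lact a (evL Z Y t z) := by
  refine forall_congr' fun a => ?_
  refine (evL Z Y).injective.eq_iff.symm.trans ?_
  have h₁ := LinearMap.congr_fun
    (f := (evL Z Y).toLinearMap ∘ₗ LinearMap.rTensor Y.V (Z.dual.ract (op a)))
    (g := (LinearMap.lcomp k Y.V (Z.lact a)) ∘ₗ (evL Z Y).toLinearMap)
    (TensorProduct.ext' fun _ _ => rfl) t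
  have h₂ := LinearMap.congr_fun
    (f := (evL Z Y).toLinearMap ∘ₗ LinearMap.lTensor Z.dual.V (Y.lact a))
    (g := (LinearMap.llcomp k Z.V Y.V Y.V (Y.lact a)) ∘ₗ (evL Z Y).toLinearMap)
    (TensorProduct.ext' fun (f : Module.Dual k Z.V) y => LinearMap.ext fun z =>
      (map_smul (Y.lact a) (f z) y).symm) t
  exact ⟨fun h z => LinearMap.congr_fun (h₁.symm.trans (h.trans h₂)) z,
    fun h => h₁.trans (Eq.trans (LinearMap.ext (f := evL Z Y t ∘ₗ Z.lact a) (g := Y.lact a ∘ₗ evL Z Y t) h) h₂.symm)⟩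

theorem mem_cobal_right {Z Y : FDBimod k A} {t : (tensK Y Z.dual).V} :
    t ∈ cobal Y Z.dual ↔
      ∀ a z, Y.ract (op a) (evR Z Y t z) = evR Z Y t (Z.ract (op a) z) := by
  refine forall_congr' fun a => ?_
  refine (evR Z Y).injective.eq_iff.symm.trans ?_
  have h₁ := LinearMap.congr_fun
    (f := (evR Z Y).toLinearMap ∘ₗ LinearMap.rTensor Z.dual.V (Y.ract (op a)))
    (g := (LinearMap.llcomp k Z.V Y.V Y.V (Y.ract (op a))) ∘ₗ (evR Z Y).toLinearMap)
    (TensorProduct.ext' fun y (f : Module.Dual k Z.V) => LinearMap.ext fun z =>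
      (map_smul (Y.ract (op a)) (f z) y).symm) t
  have h₂ := LinearMap.congr_fun
    (f := (evR Z Y).toLinearMap ∘ₗ LinearMap.lTensor Y.V (Z.dual.lact a))
    (g := (LinearMap.lcomp k Y.V (Z.ract (op a))) ∘ₗ (evR Z Y).toLinearMap)
    (TensorProduct.ext' fun _ _ => rfl) t
  exact ⟨fun h z => LinearMap.congr_fun (h₁.symm.trans (h.trans h₂)) z,
    fun h => h₁.trans (Eq.trans (LinearMap.ext (f := Y.ract (op a) ∘ₗ evR Z Y t)
      (g := evR Z Y t ∘ₗ Z.ract (op a)) h) h₂.symm)⟩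

/-- The adjunction bijection `Hom(Z ⊗_A X, Y) ≅ Hom(X, Z^* ⊗^A Y)`: a homomorphism `ψ` corresponds
to `x ↦ ψ([- ⊗ x])`, with linear maps `Z → Y` regarded as elements of `Z^* ⊗ₖ Y`. -/
def homEquivL (Z X Y : FDBimod k A) : (tensA Z X ⟶ Y) ≃ (X ⟶ cotens Z.dual Y) where
  toFun ψ := liftC (Y := Z.dual) (Z := Y)
    { lin := (evL Z Y).symm.toLinearMap ∘ₗ ((mkA Z X).compr₂ (Hom.lin ψ)).flip
      map_l := fun a x => (evL Z Y).injective (by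
        rw [evL_lact]
        ext z
        simp [LinearEquiv.apply_symm_apply, tmulA_bal])
      map_r := fun b x => (evL Z Y).injective (by
        rw [evL_ract]
        ext z
        simp [LinearEquiv.apply_symm_apply, ← Hom.map_r ψ]) }
    (fun x => mem_cobal_left.2 fun a z => by
      simp [LinearEquiv.apply_symm_apply, ← Hom.map_l ψ])
  invFun χ := descA
    { lin := TensorProduct.lift ((evL Z Y).toLinearMap ∘ₗ Hom.lin (χ ≫ ι Z.dual Y)).flip
      map_l := fun a t => LinearMap.congr_fun
        (f := TensorProduct.lift ((evL Z Y).toLinearMap ∘ₗ Hom.lin (χ ≫ ι Z.dual Y)).flip ∘ₗ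
          LinearMap.rTensor X.V (Z.lact a))
        (g := Y.lact a ∘ₗ
          TensorProduct.lift ((evL Z Y).toLinearMap ∘ₗ Hom.lin (χ ≫ ι Z.dual Y)).flip)
        (TensorProduct.ext' fun z x => mem_cobal_left.1 (ι_mem (Hom.lin χ x)) a z) t
      map_r := fun b t => LinearMap.congr_fun
        (f := TensorProduct.lift ((evL Z Y).toLinearMap ∘ₗ Hom.lin (χ ≫ ι Z.dual Y)).flip ∘ₗ
          LinearMap.lTensor Z.V (X.ract b))
        (g := Y.ract b ∘ₗ
          TensorProduct.lift ((evL Z Y).toLinearMap ∘ₗ Hom.lin (χ ≫ ι Z.dual Y)).flip)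
        (TensorProduct.ext' fun z x => by
          change evL Z Y (Hom.lin (χ ≫ ι Z.dual Y) (X.ract b x)) z =
            Y.ract b (evL Z Y (Hom.lin (χ ≫ ι Z.dual Y) x) z)
          rw [Hom.map_r, evL_ract]
          rfl) t }
    (fun z a x => by
      change evL Z Y (Hom.lin (χ ≫ ι Z.dual Y) x) _ =
        evL Z Y (Hom.lin (χ ≫ ι Z.dual Y) (X.lact a x)) z
      rw [Hom.map_l, evL_lact]
      rfl)
  left_inv ψ := tensA_hom_ext fun z x => LinearMap.congr_fun
    ((evL Z Y).apply_symm_apply (((mkA Z X).compr₂ (Hom.lin ψ)).flip x)) z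
  right_inv χ := cotens_hom_ext (hom_ext fun x =>
    (evL Z Y).symm_apply_apply (Hom.lin (χ ≫ ι Z.dual Y) x))

/-- The adjunction bijection `Hom(X ⊗_A Z, Y) ≅ Hom(X, Y ⊗^A Z^*)`: a homomorphism `ψ` corresponds
to `x ↦ ψ([x ⊗ -])`, with linear maps `Z → Y` regarded as elements of `Y ⊗ₖ Z^*`. -/
def homEquivR (Z X Y : FDBimod k A) : (tensA X Z ⟶ Y) ≃ (X ⟶ cotens Y Z.dual) where
  toFun ψ := liftC (Y := Y) (Z := Z.dual)
    { lin := (evR Z Y).symm.toLinearMap ∘ₗ (mkA X Z).compr₂ (Hom.lin ψ)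
      map_l := fun a x => (evR Z Y).injective (by
        rw [evR_lact]
        ext z
        simp [LinearEquiv.apply_symm_apply, ← Hom.map_l ψ])
      map_r := fun b x => (evR Z Y).injective (by
        rw [evR_ract]
        ext z
        simp [LinearEquiv.apply_symm_apply, ← tmulA_bal]) }
    (fun x => mem_cobal_right.2 fun a z => by
      simp [LinearEquiv.apply_symm_apply, ← Hom.map_r ψ])
  invFun χ := descA
    { lin := TensorProduct.lift ((evR Z Y).toLinearMap ∘ₗ Hom.lin (χ ≫ ι Y Z.dual))
      map_l := fun a t => LinearMap.congr_fun
        (f := TensorProduct.lift ((evR Z Y).toLinearMap ∘ₗ Hom.lin (χ ≫ ι Y Z.dual)) ∘ₗ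
          LinearMap.rTensor Z.V (X.lact a))
        (g := Y.lact a ∘ₗ
          TensorProduct.lift ((evR Z Y).toLinearMap ∘ₗ Hom.lin (χ ≫ ι Y Z.dual)))
        (TensorProduct.ext' fun x z => by
          change evR Z Y (Hom.lin (χ ≫ ι Y Z.dual) (X.lact a x)) z =
            Y.lact a (evR Z Y (Hom.lin (χ ≫ ι Y Z.dual) x) z)
          rw [Hom.map_l, evR_lact]
          rfl) t
      map_r := fun b t => LinearMap.congr_fun
        (f := TensorProduct.lift ((evR Z Y).toLinearMap ∘ₗ Hom.lin (χ ≫ ι Y Z.dual)) ∘ₗ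
          LinearMap.lTensor X.V (Z.ract b))
        (g := Y.ract b ∘ₗ
          TensorProduct.lift ((evR Z Y).toLinearMap ∘ₗ Hom.lin (χ ≫ ι Y Z.dual)))
        (TensorProduct.ext' fun x z =>
          (mem_cobal_right.1 (ι_mem (Hom.lin χ x)) (unop b) z).symm) t }
    (fun x a z => by
      change evR Z Y (Hom.lin (χ ≫ ι Y Z.dual) (X.ract (op a) x)) z =
        evR Z Y (Hom.lin (χ ≫ ι Y Z.dual) x) (Z.lact a z)
      rw [Hom.map_r, evR_ract]
      rfl)
  left_inv ψ := tensA_hom_ext fun x z => LinearMap.congr_fun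
    ((evR Z Y).apply_symm_apply ((mkA X Z).compr₂ (Hom.lin ψ) x)) z
  right_inv χ := cotens_hom_ext (hom_ext fun x =>
    (evR Z Y).symm_apply_apply (Hom.lin (χ ≫ ι Y Z.dual) x))

theorem mapC_id (X Y : FDBimod k A) : mapC (𝟙 X) (𝟙 Y) = 𝟙 (cotens X Y) :=
  cotens_hom_ext (hom_ext fun _ => LinearMap.congr_fun TensorProduct.map_id _)

theorem mapC_comp {X X' X'' Y Y' Y'' : FDBimod k A} (f : X ⟶ X') (f' : X' ⟶ X'') (g : Y ⟶ Y')
    (g' : Y' ⟶ Y'') : mapC (f ≫ f') (g ≫ g') = mapC f g ≫ mapC f' g' :=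
  cotens_hom_ext (hom_ext fun _ =>
    LinearMap.congr_fun (TensorProduct.map_comp f'.lin g'.lin f.lin g.lin) _)

/-- The internal Hom `iHom^l(Z, -) = Z^* ⊗^A -`. -/
def iHomL (Z : FDBimod k A) : FDBimod k A ⥤ FDBimod k A where
  obj Y := cotens Z.dual Y
  map g := mapC (𝟙 Z.dual) g
  map_id Y := mapC_id Z.dual Y
  map_comp g g' := mapC_comp (𝟙 Z.dual) (𝟙 Z.dual) g g'

/-- The internal Hom `iHom^r(Z, -) = - ⊗^A Z^*`. -/
def iHomR (Z : FDBimod k A) : FDBimod k A ⥤ FDBimod k A where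
  obj Y := cotens Y Z.dual
  map g := mapC g (𝟙 Z.dual)
  map_id Y := mapC_id Y Z.dual
  map_comp g g' := mapC_comp g g' (𝟙 Z.dual) (𝟙 Z.dual)

variable [Module.Finite k A]

/-- The internal Hom adjunction `Hom(Z ⊗_A X, Y) ≅ Hom(X, iHom^l(Z, Y))`. -/
def adjL (Z : FDBimod k A) : tensorLeft Z ⊣ iHomL Z :=
  Adjunction.mkOfHomEquiv
    { homEquiv := fun X Y => homEquivL Z X Y
      homEquiv_naturality_left_symm := fun _ _ => tensA_hom_ext fun _ _ => rfl
      homEquiv_naturality_right := fun {X Y Y'} ψ g => cotens_hom_ext (hom_ext fun x =>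
        (evL Z Y').injective ((LinearEquiv.apply_symm_apply _ _).trans
          (Eq.trans (congrArg (fun h => Hom.lin g ∘ₗ h) (LinearEquiv.apply_symm_apply (evL Z Y)
            (((mkA Z X).compr₂ (Hom.lin ψ)).flip x)).symm) (evL_map g _).symm))) }

/-- The internal Hom adjunction `Hom(X ⊗_A Z, Y) ≅ Hom(X, iHom^r(Z, Y))`. -/
def adjR (Z : FDBimod k A) : tensorRight Z ⊣ iHomR Z :=
  Adjunction.mkOfHomEquiv
    { homEquiv := fun X Y => homEquivR Z X Y
      homEquiv_naturality_left_symm := fun _ _ => tensA_hom_ext fun _ _ => rfl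
      homEquiv_naturality_right := fun {X Y Y'} ψ g => cotens_hom_ext (hom_ext fun x =>
        (evR Z Y').injective ((LinearEquiv.apply_symm_apply _ _).trans
          (Eq.trans (congrArg (fun h => Hom.lin g ∘ₗ h) (LinearEquiv.apply_symm_apply (evR Z Y)
            ((mkA X Z).compr₂ (Hom.lin ψ) x)).symm) (evR_map g _).symm))) }

end InternalHom

section CoMonoidal

variable {k A : Type u} [Field k] [Ring A] [Algebra k A]

theorem mem_range_lTensor {W M : Type u} [AddCommGroup W] [Module k W] [AddCommGroup M]
    [Module k M] {S : Submodule k M} {I : Type u} (f g : I → M →ₗ[k] M)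
    (hS : ∀ m, (∀ i, f i m = g i m) → m ∈ S) (t : W ⊗[k] M)
    (h : ∀ i, LinearMap.lTensor W (f i) t = LinearMap.lTensor W (g i) t) :
    ∃ s : W ⊗[k] S, LinearMap.lTensor W S.subtype s = t := by
  classical
  let b := Module.Basis.ofVectorSpace k W
  let e : W ⊗[k] M ≃ₗ[k] _ := TensorProduct.equivFinsuppOfBasisLeft b
  have he : ∀ (φ : M →ₗ[k] M) (j), e (LinearMap.lTensor W φ t) j = φ (e t j) := fun φ j =>
    LinearMap.congr_fun (f := Finsupp.lapply j ∘ₗ e.toLinearMap ∘ₗ LinearMap.lTensor W φ)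
      (g := φ ∘ₗ Finsupp.lapply j ∘ₗ e.toLinearMap)
      (TensorProduct.ext' fun w m => by simp [e]) t
  have hmem : ∀ j, e t j ∈ S := fun j => hS _ fun i => by rw [← he, ← he, h i]
  have ht : (e t).sum (fun j m => b j ⊗ₜ[k] m) = t :=
    (TensorProduct.equivFinsuppOfBasisLeft_symm_apply b (e t)).symm.trans (e.symm_apply_apply t)
  refine ⟨∑ j ∈ (e t).support, b j ⊗ₜ[k] ⟨e t j, hmem j⟩, ?_⟩
  rw [map_sum]
  exact Eq.trans (Finset.sum_congr rfl fun j _ => by simp) ht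

theorem mem_range_rTensor {W M : Type u} [AddCommGroup W] [Module k W] [AddCommGroup M]
    [Module k M] {S : Submodule k M} {I : Type u} (f g : I → M →ₗ[k] M)
    (hS : ∀ m, (∀ i, f i m = g i m) → m ∈ S) (t : M ⊗[k] W)
    (h : ∀ i, LinearMap.rTensor W (f i) t = LinearMap.rTensor W (g i) t) :
    ∃ s : S ⊗[k] W, LinearMap.rTensor W S.subtype s = t := by
  have hc : ∀ φ : M →ₗ[k] M, LinearMap.lTensor W φ (TensorProduct.comm k M W t) =
      TensorProduct.comm k M W (LinearMap.rTensor W φ t) := fun φ => LinearMap.congr_fun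
    (f := LinearMap.lTensor W φ ∘ₗ (TensorProduct.comm k M W).toLinearMap)
    (g := (TensorProduct.comm k M W).toLinearMap ∘ₗ LinearMap.rTensor W φ) (by ext; simp) t
  obtain ⟨s, hs⟩ := mem_range_lTensor f g hS (TensorProduct.comm k M W t)
    (fun i => by rw [hc, hc, h i])
  refine ⟨TensorProduct.comm k W S s, (TensorProduct.comm k M W).injective (Eq.trans ?_ hs)⟩
  exact LinearMap.congr_fun
    (f := (TensorProduct.comm k M W).toLinearMap ∘ₗ LinearMap.rTensor W S.subtype ∘ₗ
      (TensorProduct.comm k W S).toLinearMap)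
    (g := LinearMap.lTensor W S.subtype) (by ext; simp) s

/-- The inclusion of `X ⊗^A (Y ⊗^A Z)` into `X ⊗ₖ (Y ⊗ₖ Z)`. -/
def ιr (X Y Z : FDBimod k A) : cotens X (cotens Y Z) ⟶ tensK X (tensK Y Z) :=
  ι X (cotens Y Z) ≫ mapK (𝟙 X) (ι Y Z)

/-- The inclusion of `(X ⊗^A Y) ⊗^A Z` into `X ⊗ₖ (Y ⊗ₖ Z)`. -/
def ιl (X Y Z : FDBimod k A) : cotens (cotens X Y) Z ⟶ tensK X (tensK Y Z) :=
  ι (cotens X Y) Z ≫ mapK (ι X Y) (𝟙 Z) ≫ (assocK X Y Z).hom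

theorem lTensor_ι_injective (X Y Z : FDBimod k A) :
    Function.Injective (Hom.lin (mapK (𝟙 X) (ι Y Z))) :=
  Module.Flat.lTensor_preserves_injective_linearMap (M := X.V) (cobal Y Z).subtype
    Subtype.val_injective

theorem rTensor_ι_injective (X Y Z : FDBimod k A) :
    Function.Injective (Hom.lin (mapK (ι X Y) (𝟙 Z))) :=
  Module.Flat.rTensor_preserves_injective_linearMap (M := Z.V) (cobal X Y).subtype
    Subtype.val_injective

theorem ιr_injective (X Y Z : FDBimod k A) : Function.Injective (Hom.lin (ιr X Y Z)) :=
  (lTensor_ι_injective X Y Z).comp (ι_injective X (cotens Y Z))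

theorem ιl_injective (X Y Z : FDBimod k A) : Function.Injective (Hom.lin (ιl X Y Z)) :=
  (TensorProduct.assoc k X.V Y.V Z.V).injective.comp
    ((rTensor_ι_injective X Y Z).comp (ι_injective (cotens X Y) Z))

/-- The elements of `X ⊗ₖ (Y ⊗ₖ Z)` that are cobalanced in both positions. -/
def IsCobal₃ {X Y Z : FDBimod k A} (t : X.V ⊗[k] (Y.V ⊗[k] Z.V)) : Prop :=
  (∀ a : A, LinearMap.rTensor (Y.V ⊗[k] Z.V) (X.ract (op a)) t =
    LinearMap.lTensor X.V (LinearMap.rTensor Z.V (Y.lact a)) t) ∧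
  (∀ a : A, LinearMap.lTensor X.V (LinearMap.rTensor Z.V (Y.ract (op a))) t =
    LinearMap.lTensor X.V (LinearMap.lTensor Y.V (Z.lact a)) t)

theorem range_ιr {X Y Z : FDBimod k A} (t : X.V ⊗[k] (Y.V ⊗[k] Z.V)) :
    (∃ s, Hom.lin (ιr X Y Z) s = t) ↔ IsCobal₃ t := by
  constructor
  · rintro ⟨s, rfl⟩
    refine ⟨mapK_mem_cobal (𝟙 X) (ι Y Z) (ι_mem s), fun a => ?_⟩
    exact LinearMap.congr_fun
      (f := LinearMap.lTensor X.V (LinearMap.rTensor Z.V (Y.ract (op a))) ∘ₗ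
        LinearMap.lTensor X.V (cobal Y Z).subtype)
      (g := LinearMap.lTensor X.V (LinearMap.lTensor Y.V (Z.lact a)) ∘ₗ
        LinearMap.lTensor X.V (cobal Y Z).subtype)
      (TensorProduct.ext' fun x u => congrArg (fun v => x ⊗ₜ[k] v) (u.2 a)) s.1
  · rintro ⟨h₁, h₂⟩
    obtain ⟨s, rfl⟩ := mem_range_lTensor (S := cobal Y Z)
      (fun a : A => LinearMap.rTensor Z.V (Y.ract (op a)))
      (fun a : A => LinearMap.lTensor Y.V (Z.lact a)) (fun m hm => hm) t h₂
    refine ⟨⟨s, fun a => lTensor_ι_injective X Y Z ?_⟩, rfl⟩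
    have e₁ := LinearMap.congr_fun
      (f := LinearMap.lTensor X.V (cobal Y Z).subtype ∘ₗ
        LinearMap.rTensor (cobal Y Z) (X.ract (op a)))
      (g := LinearMap.rTensor (Y.V ⊗[k] Z.V) (X.ract (op a)) ∘ₗ
        LinearMap.lTensor X.V (cobal Y Z).subtype) (TensorProduct.ext' fun x u => rfl) s
    have e₂ := LinearMap.congr_fun
      (f := LinearMap.lTensor X.V (cobal Y Z).subtype ∘ₗ
        LinearMap.lTensor X.V ((cotens Y Z).lact a))
      (g := LinearMap.lTensor X.V (LinearMap.rTensor Z.V (Y.lact a)) ∘ₗ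
        LinearMap.lTensor X.V (cobal Y Z).subtype) (TensorProduct.ext' fun x u => rfl) s
    exact e₁.trans ((h₁ a).trans e₂.symm)

theorem range_ιl {X Y Z : FDBimod k A} (t : X.V ⊗[k] (Y.V ⊗[k] Z.V)) :
    (∃ s, Hom.lin (ιl X Y Z) s = t) ↔ IsCobal₃ t := by
  obtain ⟨t, rfl⟩ := (TensorProduct.assoc k X.V Y.V Z.V).surjective t
  have hX : ∀ a : A, LinearMap.rTensor (Y.V ⊗[k] Z.V) (X.ract (op a))
      (TensorProduct.assoc k X.V Y.V Z.V t) = TensorProduct.assoc k X.V Y.V Z.V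
      (LinearMap.rTensor Z.V (LinearMap.rTensor Y.V (X.ract (op a))) t) := fun a =>
    LinearMap.congr_fun (f := LinearMap.rTensor (Y.V ⊗[k] Z.V) (X.ract (op a)) ∘ₗ
      (TensorProduct.assoc k X.V Y.V Z.V).toLinearMap)
      (g := (TensorProduct.assoc k X.V Y.V Z.V).toLinearMap ∘ₗ
        LinearMap.rTensor Z.V (LinearMap.rTensor Y.V (X.ract (op a)))) (by ext; simp) t
  have hY : ∀ f : Y.V →ₗ[k] Y.V, LinearMap.lTensor X.V (LinearMap.rTensor Z.V f)
      (TensorProduct.assoc k X.V Y.V Z.V t) = TensorProduct.assoc k X.V Y.V Z.V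
      (LinearMap.rTensor Z.V (LinearMap.lTensor X.V f) t) := fun f =>
    LinearMap.congr_fun (f := LinearMap.lTensor X.V (LinearMap.rTensor Z.V f) ∘ₗ
      (TensorProduct.assoc k X.V Y.V Z.V).toLinearMap)
      (g := (TensorProduct.assoc k X.V Y.V Z.V).toLinearMap ∘ₗ
        LinearMap.rTensor Z.V (LinearMap.lTensor X.V f)) (by ext; simp) t
  have hZ : ∀ a : A, LinearMap.lTensor X.V (LinearMap.lTensor Y.V (Z.lact a))
      (TensorProduct.assoc k X.V Y.V Z.V t) = TensorProduct.assoc k X.V Y.V Z.V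
      (LinearMap.lTensor (X.V ⊗[k] Y.V) (Z.lact a) t) := fun a =>
    LinearMap.congr_fun (f := LinearMap.lTensor X.V (LinearMap.lTensor Y.V (Z.lact a)) ∘ₗ
      (TensorProduct.assoc k X.V Y.V Z.V).toLinearMap)
      (g := (TensorProduct.assoc k X.V Y.V Z.V).toLinearMap ∘ₗ
        LinearMap.lTensor (X.V ⊗[k] Y.V) (Z.lact a)) (by ext; simp) t
  have hinj := (TensorProduct.assoc k X.V Y.V Z.V).injective
  constructor
  · rintro ⟨s, hs⟩
    have hs' : LinearMap.rTensor Z.V (cobal X Y).subtype s.1 = t := hinj hs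
    refine ⟨fun a => ?_, fun a => ?_⟩
    · rw [hX, hY, ← hs']
      exact congrArg _ (LinearMap.congr_fun
        (f := LinearMap.rTensor Z.V (LinearMap.rTensor Y.V (X.ract (op a))) ∘ₗ
          LinearMap.rTensor Z.V (cobal X Y).subtype)
        (g := LinearMap.rTensor Z.V (LinearMap.lTensor X.V (Y.lact a)) ∘ₗ
          LinearMap.rTensor Z.V (cobal X Y).subtype)
        (TensorProduct.ext' fun u z => congrArg (fun v => v ⊗ₜ[k] z) (u.2 a)) s.1)
    · rw [hY, hZ, ← hs']
      exact congrArg _ (mapK_mem_cobal (ι X Y) (𝟙 Z) (ι_mem s) a)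
  · rintro ⟨h₁, h₂⟩
    obtain ⟨s, rfl⟩ := mem_range_rTensor (S := cobal X Y)
      (fun a : A => LinearMap.rTensor Y.V (X.ract (op a)))
      (fun a : A => LinearMap.lTensor X.V (Y.lact a)) (fun m hm => hm) t (fun a => hinj (by
        rw [← hX, ← hY]; exact h₁ a))
    refine ⟨⟨s, fun a => rTensor_ι_injective X Y Z ?_⟩, rfl⟩
    have e₁ := LinearMap.congr_fun
      (f := LinearMap.rTensor Z.V (cobal X Y).subtype ∘ₗ
        LinearMap.rTensor Z.V ((cotens X Y).ract (op a)))
      (g := LinearMap.rTensor Z.V (LinearMap.lTensor X.V (Y.ract (op a))) ∘ₗ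
        LinearMap.rTensor Z.V (cobal X Y).subtype) (TensorProduct.ext' fun x u => rfl) s
    have e₂ := LinearMap.congr_fun
      (f := LinearMap.rTensor Z.V (cobal X Y).subtype ∘ₗ
        LinearMap.lTensor (cobal X Y) (Z.lact a))
      (g := LinearMap.lTensor (X.V ⊗[k] Y.V) (Z.lact a) ∘ₗ
        LinearMap.rTensor Z.V (cobal X Y).subtype) (TensorProduct.ext' fun x u => rfl) s
    exact e₁.trans ((hinj ((hY _).symm.trans ((h₂ a).trans (hZ a)))).trans e₂.symm)

/-- Two injective homomorphisms with the same image have isomorphic sources. -/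
def isoOfRange {X Y W : FDBimod k A} (f : X ⟶ W) (g : Y ⟶ W)
    (hf : Function.Injective (Hom.lin f)) (hg : Function.Injective (Hom.lin g))
    (h : LinearMap.range (Hom.lin f) = LinearMap.range (Hom.lin g)) : X ≅ Y :=
  let e : X.V ≃ₗ[k] Y.V := (LinearEquiv.ofInjective (Hom.lin f) hf).trans
    ((LinearEquiv.ofEq _ _ h).trans (LinearEquiv.ofInjective (Hom.lin g) hg).symm)
  have he : ∀ x, Hom.lin g (e x) = Hom.lin f x := fun x =>
    congrArg Subtype.val ((LinearEquiv.ofInjective (Hom.lin g) hg).apply_symm_apply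
      (LinearEquiv.ofEq _ _ h (LinearEquiv.ofInjective (Hom.lin f) hf x)))
  mkIso ⟨e.toLinearMap, fun a x => hg ((he _).trans (by
      rw [Hom.map_l, Hom.map_l]; exact congrArg _ (he x).symm)),
    fun b x => hg ((he _).trans (by
      rw [Hom.map_r, Hom.map_r]; exact congrArg _ (he x).symm))⟩
    e.symm.toLinearMap (fun x => e.symm_apply_apply x) (fun y => e.apply_symm_apply y)

theorem isoOfRange_hom {X Y W : FDBimod k A} (f : X ⟶ W) (g : Y ⟶ W) (hf) (hg) (h) :
    (isoOfRange f g hf hg h).hom ≫ g = f :=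
  hom_ext fun x => congrArg Subtype.val ((LinearEquiv.ofInjective (Hom.lin g) hg).apply_symm_apply
      (LinearEquiv.ofEq _ _ h (LinearEquiv.ofInjective (Hom.lin f) hf x)))

/-- The associator of `⊗^A`: the restriction of the associator of vector spaces. -/
def assocC (X Y Z : FDBimod k A) : cotens (cotens X Y) Z ≅ cotens X (cotens Y Z) :=
  isoOfRange (ιl X Y Z) (ιr X Y Z) (ιl_injective X Y Z) (ιr_injective X Y Z)
    (Submodule.ext fun t => (range_ιl t).trans (range_ιr t).symm)

theorem assocC_hom_ιr (X Y Z : FDBimod k A) : (assocC X Y Z).hom ≫ ιr X Y Z = ιl X Y Z :=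
  isoOfRange_hom _ _ _ _ _


theorem mapK_comp {X X' X'' Y Y' Y'' : FDBimod k A} (f : X ⟶ X') (f' : X' ⟶ X'') (g : Y ⟶ Y')
    (g' : Y' ⟶ Y'') : mapK f g ≫ mapK f' g' = mapK (f ≫ f') (g ≫ g') :=
  Hom.ext (TensorProduct.map_comp f'.lin g'.lin f.lin g.lin).symm

theorem assocK_naturality {X X' Y Y' Z Z' : FDBimod k A} (f : X ⟶ X') (g : Y ⟶ Y') (h : Z ⟶ Z') :
    mapK (mapK f g) h ≫ (assocK X' Y' Z').hom = (assocK X Y Z).hom ≫ mapK f (mapK g h) :=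
  Hom.ext (TensorProduct.ext_threefold fun _ _ _ => rfl)

theorem pentagonK (W X Y Z : FDBimod k A) :
    mapK (assocK W X Y).hom (𝟙 Z) ≫ (assocK W (tensK X Y) Z).hom ≫ mapK (𝟙 W) (assocK X Y Z).hom =
      (assocK (tensK W X) Y Z).hom ≫ (assocK W X (tensK Y Z)).hom :=
  Hom.ext (TensorProduct.ext_fourfold fun _ _ _ _ => rfl)

theorem mapC_ιr {X X' Y Y' Z Z' : FDBimod k A} (f : X ⟶ X') (g : Y ⟶ Y') (h : Z ⟶ Z') :
    mapC f (mapC g h) ≫ ιr X' Y' Z' = ιr X Y Z ≫ mapK f (mapK g h) := by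
  rw [ιr, ιr, ← Category.assoc, mapC_ι, Category.assoc, Category.assoc, mapK_comp, mapK_comp,
    mapC_ι, Category.comp_id, Category.id_comp]

theorem mapC_ιl {X X' Y Y' Z Z' : FDBimod k A} (f : X ⟶ X') (g : Y ⟶ Y') (h : Z ⟶ Z') :
    mapC (mapC f g) h ≫ ιl X' Y' Z' = ιl X Y Z ≫ mapK f (mapK g h) := by
  rw [ιl, ιl, ← Category.assoc, mapC_ι, Category.assoc, Category.assoc, Category.assoc,
    ← assocK_naturality, ← Category.assoc (mapK _ _) (mapK _ _),
    ← Category.assoc (mapK _ _) (mapK _ _), mapK_comp, mapK_comp,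
    mapC_ι, Category.comp_id, Category.id_comp]

theorem hom_ext_ιr {W X Y Z : FDBimod k A} {f g : W ⟶ cotens X (cotens Y Z)}
    (h : f ≫ ιr X Y Z = g ≫ ιr X Y Z) : f = g :=
  hom_ext fun w => ιr_injective X Y Z (LinearMap.congr_fun (congrArg Hom.lin h) w)

theorem assocC_naturality {X X' Y Y' Z Z' : FDBimod k A} (f : X ⟶ X') (g : Y ⟶ Y') (h : Z ⟶ Z') :
    mapC (mapC f g) h ≫ (assocC X' Y' Z').hom = (assocC X Y Z).hom ≫ mapC f (mapC g h) :=
  hom_ext_ιr (by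
    rw [Category.assoc, assocC_hom_ιr, mapC_ιl, Category.assoc, mapC_ιr, ← Category.assoc,
      assocC_hom_ιr])

theorem pentagonC (W X Y Z : FDBimod k A) :
    mapC (assocC W X Y).hom (𝟙 Z) ≫ (assocC W (cotens X Y) Z).hom ≫ mapC (𝟙 W) (assocC X Y Z).hom =
      (assocC (cotens W X) Y Z).hom ≫ (assocC W X (cotens Y Z)).hom := by
  have hl : (mapC (assocC W X Y).hom (𝟙 Z) ≫ (assocC W (cotens X Y) Z).hom ≫
      mapC (𝟙 W) (assocC X Y Z).hom) ≫ ι _ _ ≫ mapK (𝟙 W) (ιr X Y Z) =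
      ι _ _ ≫ mapK (ιl W X Y) (𝟙 Z) ≫ (assocK W (tensK X Y) Z).hom ≫
        mapK (𝟙 W) (assocK X Y Z).hom := by
    calc _ = mapC (assocC W X Y).hom (𝟙 Z) ≫ (assocC W (cotens X Y) Z).hom ≫
          (mapC (𝟙 W) (assocC X Y Z).hom ≫ ι _ _) ≫ mapK (𝟙 W) (ιr X Y Z) := by
          simp only [Category.assoc]
      _ = mapC (assocC W X Y).hom (𝟙 Z) ≫ (assocC W (cotens X Y) Z).hom ≫
          ιr W (cotens X Y) Z ≫ mapK (𝟙 W) (mapK (ι X Y) (𝟙 Z) ≫ (assocK X Y Z).hom) := by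
          rw [mapC_ι, Category.assoc, mapK_comp, assocC_hom_ιr, ιr, Category.assoc, mapK_comp,
            ιl]
      _ = (mapC (assocC W X Y).hom (𝟙 Z) ≫ ι _ _) ≫ mapK (ι W (cotens X Y)) (𝟙 Z) ≫
          ((assocK W (cotens X Y) Z).hom ≫ mapK (𝟙 W) (mapK (ι X Y) (𝟙 Z))) ≫
            mapK (𝟙 W) (assocK X Y Z).hom := by
          rw [← Category.assoc (assocC _ _ _).hom, assocC_hom_ιr, ιl]
          simp only [Category.assoc, mapK_comp, Category.comp_id]
      _ = ι _ _ ≫ (mapK (assocC W X Y).hom (𝟙 Z) ≫ mapK (ι W (cotens X Y)) (𝟙 Z) ≫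
          mapK (mapK (𝟙 W) (ι X Y)) (𝟙 Z)) ≫ (assocK W (tensK X Y) Z).hom ≫
            mapK (𝟙 W) (assocK X Y Z).hom := by
          rw [mapC_ι, ← assocK_naturality]
          simp only [Category.assoc]
      _ = _ := by
          rw [mapK_comp, mapK_comp, ← ιr, assocC_hom_ιr, Category.comp_id, Category.comp_id]
  have hr : ((assocC (cotens W X) Y Z).hom ≫ (assocC W X (cotens Y Z)).hom) ≫
      ι _ _ ≫ mapK (𝟙 W) (ιr X Y Z) =
      ι _ _ ≫ mapK (ι (cotens W X) Y ≫ mapK (ι W X) (𝟙 Y)) (𝟙 Z) ≫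
        (assocK (tensK W X) Y Z).hom ≫ (assocK W X (tensK Y Z)).hom := by
    calc _ = (assocC (cotens W X) Y Z).hom ≫ ((assocC W X (cotens Y Z)).hom ≫
          ιr W X (cotens Y Z)) ≫ mapK (𝟙 W) (mapK (𝟙 X) (ι Y Z)) := by
          rw [ιr, ιr]
          simp only [Category.assoc, mapK_comp, Category.comp_id]
      _ = (assocC (cotens W X) Y Z).hom ≫ ι (cotens W X) (cotens Y Z) ≫
          (mapK (ι W X) (𝟙 (cotens Y Z)) ≫ mapK (mapK (𝟙 W) (𝟙 X)) (ι Y Z)) ≫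
            (assocK W X (tensK Y Z)).hom := by
          rw [assocC_hom_ιr, ιl]
          simp only [Category.assoc, assocK_naturality]
      _ = ((assocC (cotens W X) Y Z).hom ≫ ιr (cotens W X) Y Z) ≫
          mapK (ι W X) (𝟙 _) ≫ (assocK W X (tensK Y Z)).hom := by
          have : mapK (𝟙 W) (𝟙 X) = 𝟙 (tensK W X) := Hom.ext TensorProduct.map_id
          rw [mapK_comp, this, ιr]
          simp only [Category.assoc]
          rw [← Category.assoc (mapK _ _), mapK_comp]
          simp only [Category.comp_id, Category.id_comp]
      _ = ι _ _ ≫ mapK (ι (cotens W X) Y) (𝟙 Z) ≫ ((assocK (cotens W X) Y Z).hom ≫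
          mapK (ι W X) (mapK (𝟙 Y) (𝟙 Z))) ≫ (assocK W X (tensK Y Z)).hom := by
          have : mapK (𝟙 Y) (𝟙 Z) = 𝟙 (tensK Y Z) := Hom.ext TensorProduct.map_id
          rw [assocC_hom_ιr, ιl, this]
          simp only [Category.assoc]
      _ = _ := by
          rw [← assocK_naturality, Category.assoc, ← Category.assoc (mapK _ _), mapK_comp,
            Category.comp_id]
  have hinj : Function.Injective (Hom.lin (ι W (cotens X (cotens Y Z)) ≫ mapK (𝟙 W) (ιr X Y Z))) :=
    (Module.Flat.lTensor_preserves_injective_linearMap (M := W.V) (Hom.lin (ιr X Y Z))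
      (ιr_injective X Y Z)).comp (ι_injective W _)
  have key : (mapC (assocC W X Y).hom (𝟙 Z) ≫ (assocC W (cotens X Y) Z).hom ≫
      mapC (𝟙 W) (assocC X Y Z).hom) ≫ ι _ _ ≫ mapK (𝟙 W) (ιr X Y Z) =
      ((assocC (cotens W X) Y Z).hom ≫ (assocC W X (cotens Y Z)).hom) ≫
      ι _ _ ≫ mapK (𝟙 W) (ιr X Y Z) := by
    rw [hl, hr, ← pentagonK, ← Category.assoc (mapK _ _) (mapK _ _), mapK_comp, ιl,
      Category.comp_id, Category.assoc]
  exact hom_ext fun t => hinj (LinearMap.congr_fun (congrArg Hom.lin key) t)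

variable [Module.Finite k A]

/-- The map `A^* ⊗ₖ X → X`, `f ⊗ x ↦ f(1) x`. -/
def contrL (X : FDBimod k A) : (tensK (regular k A).dual X).V →ₗ[k] X.V where
  toFun t := evL (regular k A) X t (1 : A)
  map_add' s t := LinearMap.congr_fun (map_add (evL (regular k A) X) s t) (1 : A)
  map_smul' c t := LinearMap.congr_fun (map_smul (evL (regular k A) X) c t) (1 : A)

/-- The map `X ⊗ₖ A^* → X`, `x ⊗ f ↦ f(1) x`. -/
def contrR (X : FDBimod k A) : (tensK X (regular k A).dual).V →ₗ[k] X.V where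
  toFun t := evR (regular k A) X t (1 : A)
  map_add' s t := LinearMap.congr_fun (map_add (evR (regular k A) X) s t) (1 : A)
  map_smul' c t := LinearMap.congr_fun (map_smul (evR (regular k A) X) c t) (1 : A)

/-- The left unitor of `⊗^A`, `f ⊗ x ↦ f(1) x`. -/
def lunitC (X : FDBimod k A) : cotens (regular k A).dual X ≅ X :=
  mkIso
    { lin := contrL X ∘ₗ Hom.lin (ι (regular k A).dual X)
      map_l := fun a t =>
        (LinearMap.congr_fun (evL_lact a (Hom.lin (ι _ X) t)) (1 : A)).trans
          ((congrArg (evL (regular k A) X (Hom.lin (ι _ X) t))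
            ((one_mul a).trans (mul_one a).symm)).trans
              (mem_cobal_left.1 (ι_mem t) a (1 : A)))
      map_r := fun b t => LinearMap.congr_fun (evL_ract b (Hom.lin (ι _ X) t)) (1 : A) }
    (LinearMap.codRestrict (cobal (regular k A).dual X)
      ((evL (regular k A) X).symm.toLinearMap ∘ₗ X.lact.toLinearMap.flip) (fun x =>
        mem_cobal_left.2 fun a (b : A) => by
          have h := LinearEquiv.apply_symm_apply (evL (regular k A) X) (X.lact.toLinearMap.flip x)
          exact (LinearMap.congr_fun h (a * b : A)).trans
            ((congrArg (fun f => f x) (map_mul X.lact a b)).trans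
              (congrArg (X.lact a) (LinearMap.congr_fun h b).symm))))
    (fun t => ι_injective _ _ ((evL (regular k A) X).symm_apply_eq.2
      (LinearMap.ext fun (a : A) => ((mem_cobal_left.1 (ι_mem t) a (1 : A)).symm.trans
        (congrArg (evL (regular k A) X (Hom.lin (ι _ X) t)) (mul_one a))))))
    (fun x => (LinearMap.congr_fun (LinearEquiv.apply_symm_apply (evL (regular k A) X)
      (X.lact.toLinearMap.flip x)) (1 : A)).trans (congrArg (fun f => f x) (map_one X.lact)))

/-- The right unitor of `⊗^A`, `x ⊗ f ↦ f(1) x`. -/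
def runitC (X : FDBimod k A) : cotens X (regular k A).dual ≅ X :=
  mkIso
    { lin := contrR X ∘ₗ Hom.lin (ι X (regular k A).dual)
      map_l := fun a t => LinearMap.congr_fun (evR_lact a (Hom.lin (ι X _) t)) (1 : A)
      map_r := fun b t =>
        (LinearMap.congr_fun (evR_ract b (Hom.lin (ι X _) t)) (1 : A)).trans
          ((congrArg (evR (regular k A) X (Hom.lin (ι X _) t))
            ((mul_one (unop b)).trans (one_mul (unop b)).symm)).trans
              (mem_cobal_right.1 (ι_mem t) (unop b) (1 : A)).symm) }
    (LinearMap.codRestrict (cobal X (regular k A).dual)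
      ((evR (regular k A) X).symm.toLinearMap ∘ₗ
        (X.ract.toLinearMap ∘ₗ (MulOpposite.opLinearEquiv k).toLinearMap).flip) (fun x =>
        mem_cobal_right.2 fun a (b : A) => by
          have h := LinearEquiv.apply_symm_apply (evR (regular k A) X)
            ((X.ract.toLinearMap ∘ₗ (MulOpposite.opLinearEquiv k).toLinearMap).flip x)
          exact (congrArg (X.ract (op a)) (LinearMap.congr_fun h b)).trans
            ((congrArg (fun f => f x) (map_mul X.ract (op a) (op b))).symm.trans
              (LinearMap.congr_fun h (b * a : A)).symm)))
    (fun t => ι_injective _ _ ((evR (regular k A) X).symm_apply_eq.2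
      (LinearMap.ext fun (a : A) => ((mem_cobal_right.1 (ι_mem t) a (1 : A)).trans
        (congrArg (evR (regular k A) X (Hom.lin (ι X _) t)) (one_mul a))))))
    (fun x => (LinearMap.congr_fun (LinearEquiv.apply_symm_apply (evR (regular k A) X)
      ((X.ract.toLinearMap ∘ₗ (MulOpposite.opLinearEquiv k).toLinearMap).flip x)) (1 : A)).trans
        (congrArg (fun f => f x) (map_one X.ract)))

theorem lunitC_naturality {X Y : FDBimod k A} (f : X ⟶ Y) :
    mapC (𝟙 (regular k A).dual) f ≫ (lunitC Y).hom = (lunitC X).hom ≫ f :=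
  hom_ext fun t => LinearMap.congr_fun (evL_map f (Hom.lin (ι _ X) t)) (1 : A)

theorem runitC_naturality {X Y : FDBimod k A} (f : X ⟶ Y) :
    mapC f (𝟙 (regular k A).dual) ≫ (runitC Y).hom = (runitC X).hom ≫ f :=
  hom_ext fun t => LinearMap.congr_fun (evR_map f (Hom.lin (ι X _) t)) (1 : A)

theorem triangleC (X Y : FDBimod k A) :
    (assocC X (regular k A).dual Y).hom ≫ mapC (𝟙 X) (lunitC Y).hom =
      mapC (runitC X).hom (𝟙 Y) := by
  refine hom_ext fun t => ι_injective X Y ?_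
  have h := LinearMap.congr_fun (congrArg Hom.lin (assocC_hom_ιr X (regular k A).dual Y)) t
  have e₁ : ∀ s, Hom.lin (ι X Y) (Hom.lin (mapC (𝟙 X) (lunitC Y).hom) s) =
      LinearMap.lTensor X.V (contrL Y) (Hom.lin (ιr X (regular k A).dual Y) s) := fun s =>
    LinearMap.congr_fun (f := LinearMap.lTensor X.V (Hom.lin (lunitC Y).hom))
      (g := LinearMap.lTensor X.V (contrL Y) ∘ₗ
        LinearMap.lTensor X.V (Hom.lin (ι (regular k A).dual Y)))
      (TensorProduct.ext' fun _ _ => rfl) s.1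
  have e₂ : Hom.lin (ι X Y) (Hom.lin (mapC (runitC X).hom (𝟙 Y)) t) =
      LinearMap.lTensor X.V (contrL Y) (Hom.lin (ιl X (regular k A).dual Y) t) := by
    have e₃ := LinearMap.congr_fun (f := LinearMap.rTensor Y.V (Hom.lin (runitC X).hom))
      (g := LinearMap.rTensor Y.V (contrR X) ∘ₗ
        LinearMap.rTensor Y.V (Hom.lin (ι X (regular k A).dual)))
      (TensorProduct.ext' fun _ _ => rfl) t.1
    have e₄ := LinearMap.congr_fun (f := LinearMap.lTensor X.V (contrL Y) ∘ₗ
          (TensorProduct.assoc k X.V (regular k A).dual.V Y.V).toLinearMap)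
      (g := LinearMap.rTensor Y.V (contrR X))
      (TensorProduct.ext_threefold fun x (f : Module.Dual k A) y =>
        (TensorProduct.smul_tmul (f 1) x y).symm)
      (LinearMap.rTensor Y.V (Hom.lin (ι X (regular k A).dual)) t.1)
    exact e₃.trans e₄.symm
  exact (e₁ _).trans (Eq.trans (congrArg _ h) e₂.symm)

end CoMonoidal

end FDBimod

/-- The category of finite-dimensional bimodules, regarded as a monoidal category via `⊗^A`. -/
def CoBimod (k A : Type u) [Field k] [Ring A] [Algebra k A] : Type (u + 1) := FDBimod k A

namespace FDBimod

section Action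

variable {k A : Type u} [Field k] [Ring A] [Algebra k A]

instance : Category (CoBimod k A) := inferInstanceAs (Category (FDBimod k A))

variable [Module.Finite k A]

instance : MonoidalCategoryStruct (CoBimod k A) where
  tensorObj X Y := cotens (k := k) (A := A) X Y
  tensorHom f g := mapC (k := k) (A := A) f g
  whiskerLeft X _ _ g := mapC (k := k) (A := A) (𝟙 X) g
  whiskerRight f Y := mapC (k := k) (A := A) f (𝟙 Y)
  tensorUnit := (regular k A).dual
  associator X Y Z := assocC (k := k) (A := A) X Y Z
  leftUnitor X := lunitC (k := k) (A := A) X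
  rightUnitor X := runitC (k := k) (A := A) X

/-- The monoidal category of finite-dimensional bimodules with `⊗^A` as tensor product. -/
instance : MonoidalCategory (CoBimod k A) :=
  MonoidalCategory.ofTensorHom
    (id_tensorHom_id := fun X Y => mapC_id (k := k) (A := A) X Y)
    (id_tensorHom := fun _ _ _ _ => rfl)
    (tensorHom_id := fun _ _ => rfl)
    (tensorHom_comp_tensorHom := fun f₁ f₂ g₁ g₂ =>
      (mapC_comp (k := k) (A := A) f₁ g₁ f₂ g₂).symm)
    (associator_naturality := fun f g h => assocC_naturality (k := k) (A := A) f g h)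
    (leftUnitor_naturality := fun f => lunitC_naturality (k := k) (A := A) f)
    (rightUnitor_naturality := fun f => runitC_naturality (k := k) (A := A) f)
    (pentagon := fun W X Y Z => pentagonC (k := k) (A := A) W X Y Z)
    (triangle := fun X Y => triangleC (k := k) (A := A) X Y)

/-- The action of the monoidal category of bimodules with `⊗^A` on itself from the left. -/
instance : MonoidalLeftAction (CoBimod k A) (FDBimod k A) :=
  inferInstanceAs (MonoidalLeftAction (CoBimod k A) (CoBimod k A))

end Action

section Transport

open Functor

universe v₁ v₂ v₃ u₁ u₂ u₃

variable {C : Type u₁} [Category.{v₁} C] [MonoidalCategory C] {D : Type u₂} [Category.{v₂} D]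
  {D' : Type u₃} [Category.{v₃} D'] {F : D ⥤ D'} {G : D' ⥤ D}

theorem pentagon_inv_hom (a b c d : C) : (α_ (a ⊗ b) c d).inv ≫ (α_ a b c).hom ▷ d =
    (α_ a b (c ⊗ d)).hom ≫ a ◁ (α_ b c d).inv ≫ (α_ a (b ⊗ c) d).inv := by monoidal

open MonoidalLeftAction in
/-- The lax module functor structure on a right adjoint `G` that corresponds to an oplax module
functor structure on its left adjoint `F`. -/
@[reducible] def laxLeftOfAdj [MonoidalLeftAction C D] [MonoidalLeftAction C D'] (adj : F ⊣ G)
    [F.OplaxLeftLinear C] : G.LaxLeftLinear C where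
  μₗ c d := adj.homEquiv _ _ (OplaxLeftLinear.δₗ F c (G.obj d) ≫ c ⊴ₗ adj.counit.app d)
  μₗ_naturality_left f d := by
    apply (adj.homEquiv _ _).symm.injective
    rw [Adjunction.homEquiv_naturality_left_symm, Adjunction.homEquiv_naturality_right_symm,
      Equiv.symm_apply_apply, Equiv.symm_apply_apply]
    simp only [Category.assoc, OplaxLeftLinear.δₗ_naturality_left_assoc, action_exchange]
  μₗ_naturality_right c d d' f := by
    apply (adj.homEquiv _ _).symm.injective
    rw [Adjunction.homEquiv_naturality_left_symm, Adjunction.homEquiv_naturality_right_symm,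
      Equiv.symm_apply_apply, Equiv.symm_apply_apply]
    simp only [Category.assoc, OplaxLeftLinear.δₗ_naturality_right_assoc,
      ← MonoidalLeftAction.actionHomRight_comp, Adjunction.counit_naturality]
  μₗ_associativity c c' d := by
    apply (adj.homEquiv _ _).symm.injective
    rw [Adjunction.homEquiv_naturality_right_symm, Adjunction.homEquiv_naturality_left_symm,
      Adjunction.homEquiv_naturality_left_symm, Equiv.symm_apply_apply, Equiv.symm_apply_apply]
    simp only [Category.assoc, OplaxLeftLinear.δₗ_naturality_right_assoc,
      ← MonoidalLeftAction.actionHomRight_comp]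
    rw [← Adjunction.homEquiv_counit, Equiv.symm_apply_apply]
    simp [← OplaxLeftLinear.δₗ_associativity_assoc]
  μₗ_unitality d := by
    apply (adj.homEquiv _ _).symm.injective
    rw [Adjunction.homEquiv_naturality_right_symm, Equiv.symm_apply_apply]
    simp [Adjunction.homEquiv_counit]

open MonoidalRightAction in
/-- The lax right module functor structure on a right adjoint `G` that corresponds to an oplax
right module functor structure on its left adjoint `F`. -/
@[reducible] def laxRightOfAdj [MonoidalRightAction C D] [MonoidalRightAction C D'] (adj : F ⊣ G)
    [F.OplaxRightLinear C] : G.LaxRightLinear C where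
  μᵣ d c := adj.homEquiv _ _ (OplaxRightLinear.δᵣ F (G.obj d) c ≫ adj.counit.app d ⊵ᵣ c)
  μᵣ_naturality_right d c c' f := by
    apply (adj.homEquiv _ _).symm.injective
    rw [Adjunction.homEquiv_naturality_left_symm, Adjunction.homEquiv_naturality_right_symm,
      Equiv.symm_apply_apply, Equiv.symm_apply_apply]
    simp only [Category.assoc, OplaxRightLinear.δᵣ_naturality_right_assoc, action_exchange]
    rfl
  μᵣ_naturality_left f c := by
    apply (adj.homEquiv _ _).symm.injective
    rw [Adjunction.homEquiv_naturality_left_symm, Adjunction.homEquiv_naturality_right_symm,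
      Equiv.symm_apply_apply, Equiv.symm_apply_apply]
    simp only [Category.assoc, OplaxRightLinear.δᵣ_naturality_left_assoc,
      ← MonoidalRightAction.comp_actionHomLeft]
    exact congrArg (fun g => OplaxRightLinear.δᵣ F (G.obj _) c ≫ g ⊵ᵣ c) (adj.counit_naturality f)
  μᵣ_associativity d c c' := by
    apply (adj.homEquiv _ _).symm.injective
    rw [Adjunction.homEquiv_naturality_right_symm, Adjunction.homEquiv_naturality_left_symm,
      Adjunction.homEquiv_naturality_left_symm, Equiv.symm_apply_apply, Equiv.symm_apply_apply]
    simp only [Category.assoc, OplaxRightLinear.δᵣ_naturality_left_assoc,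
      ← MonoidalRightAction.comp_actionHomLeft]
    have h := (adj.homEquiv_counit (g := adj.homEquiv _ _
      (OplaxRightLinear.δᵣ F (G.obj d) c ≫ adj.counit.app d ⊵ᵣ c))).symm.trans
      (Equiv.symm_apply_apply _ _)
    refine Eq.trans ?_ (congrArg (fun g => F.map (αᵣ (G.obj d) c c').hom ≫
      OplaxRightLinear.δᵣ F (G.obj d ⊙ᵣ c) c' ≫ g ⊵ᵣ c') h).symm
    simp [← OplaxRightLinear.δᵣ_associativity_assoc]
  μᵣ_unitality d := by
    apply (adj.homEquiv _ _).symm.injective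
    rw [Adjunction.homEquiv_naturality_right_symm, Equiv.symm_apply_apply]
    simp [Adjunction.homEquiv_counit]

open MonoidalLeftAction in
/-- The oplax module functor structure on a left adjoint `F` that corresponds to a lax module
functor structure on its right adjoint `G`. -/
@[reducible] def oplaxLeftOfAdj [MonoidalLeftAction C D] [MonoidalLeftAction C D'] (adj : F ⊣ G)
    [G.LaxLeftLinear C] : F.OplaxLeftLinear C where
  δₗ c d := (adj.homEquiv _ _).symm (c ⊴ₗ adj.unit.app d ≫ LaxLeftLinear.μₗ G c (F.obj d))
  δₗ_naturality_left f d := by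
    apply (adj.homEquiv _ _).injective
    rw [Adjunction.homEquiv_naturality_left, Adjunction.homEquiv_naturality_right,
      Equiv.apply_symm_apply, Equiv.apply_symm_apply]
    simp only [Category.assoc, ← LaxLeftLinear.μₗ_naturality_left]
    rw [← Category.assoc, ← Category.assoc]
    exact congrArg (· ≫ LaxLeftLinear.μₗ G _ (F.obj d))
      (MonoidalLeftAction.action_exchange f (adj.unit.app d)).symm
  δₗ_naturality_right c d d' f := by
    apply (adj.homEquiv _ _).injective
    rw [Adjunction.homEquiv_naturality_left, Adjunction.homEquiv_naturality_right,
      Equiv.apply_symm_apply, Equiv.apply_symm_apply]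
    simp only [Category.assoc, ← LaxLeftLinear.μₗ_naturality_right]
    simp only [← MonoidalLeftAction.actionHomRight_comp_assoc, Adjunction.unit_naturality]
  δₗ_associativity c c' d := by
    apply (adj.homEquiv _ _).injective
    rw [Adjunction.homEquiv_naturality_left, Adjunction.homEquiv_naturality_right,
      Adjunction.homEquiv_naturality_right, Equiv.apply_symm_apply, Equiv.apply_symm_apply]
    simp only [Category.assoc, ← LaxLeftLinear.μₗ_naturality_right]
    simp only [← MonoidalLeftAction.actionHomRight_comp_assoc]
    rw [← Adjunction.homEquiv_unit, Equiv.apply_symm_apply]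
    simp
  δₗ_unitality_inv d := by
    apply (adj.homEquiv _ _).injective
    rw [Adjunction.homEquiv_naturality_left, Equiv.apply_symm_apply]
    simp [Adjunction.homEquiv_unit]

end Transport

section Distributors

variable {k A : Type u} [Field k] [Ring A] [Algebra k A]

/-! ### The maps constructed from equalizers and coequalizers -/

/-- The map `γ^l`, through which `α⁻¹ ∘ (X ⊗ₖ ι)` factors. -/
def γL (X Y Z : FDBimod k A) : tensK X (cotens Y Z) ⟶ cotens (tensK X Y) Z :=
  liftC (mapK (𝟙 X) (ι Y Z) ≫ (assocK X Y Z).inv) (fun t => by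
    induction t using TensorProduct.induction_on with
    | zero => exact ((cobal (tensK X Y) Z).comap
        (Hom.lin (mapK (𝟙 X) (ι Y Z) ≫ (assocK X Y Z).inv))).zero_mem
    | add s t hs ht => exact ((cobal (tensK X Y) Z).comap
        (Hom.lin (mapK (𝟙 X) (ι Y Z) ≫ (assocK X Y Z).inv))).add_mem hs ht
    | tmul x s =>
      intro a
      have h₁ := LinearMap.congr_fun
        (f := LinearMap.rTensor Z.V (LinearMap.lTensor X.V (Y.ract (op a))) ∘ₗ
          (TensorProduct.assoc k X.V Y.V Z.V).symm.toLinearMap)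
        (g := (TensorProduct.assoc k X.V Y.V Z.V).symm.toLinearMap ∘ₗ
          LinearMap.lTensor X.V (LinearMap.rTensor Z.V (Y.ract (op a))))
        (TensorProduct.ext (LinearMap.ext fun _ => TensorProduct.ext' fun _ _ => rfl))
        (x ⊗ₜ[k] Hom.lin (ι Y Z) s)
      have h₂ := LinearMap.congr_fun
        (f := LinearMap.lTensor (X.V ⊗[k] Y.V) (Z.lact a) ∘ₗ
          (TensorProduct.assoc k X.V Y.V Z.V).symm.toLinearMap)
        (g := (TensorProduct.assoc k X.V Y.V Z.V).symm.toLinearMap ∘ₗ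
          LinearMap.lTensor X.V (LinearMap.lTensor Y.V (Z.lact a)))
        (TensorProduct.ext (LinearMap.ext fun _ => TensorProduct.ext' fun _ _ => rfl))
        (x ⊗ₜ[k] Hom.lin (ι Y Z) s)
      exact h₁.trans ((congrArg (fun u => (TensorProduct.assoc k X.V Y.V Z.V).symm (x ⊗ₜ[k] u))
        (ι_mem s a)).trans h₂.symm))

theorem γL_ι (X Y Z : FDBimod k A) :
    γL X Y Z ≫ ι (tensK X Y) Z = mapK (𝟙 X) (ι Y Z) ≫ (assocK X Y Z).inv := rfl

/-- The map `∂^l`, through which `(π ⊗^A Z) ∘ γ^l` factors. -/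
def distL (X Y Z : FDBimod k A) : tensA X (cotens Y Z) ⟶ cotens (tensA X Y) Z :=
  descA (γL X Y Z ≫ mapC (π X Y) (𝟙 Z)) (fun x a s => ι_injective _ _ (LinearMap.congr_fun
    (f := LinearMap.rTensor Z.V (Hom.lin (π X Y)) ∘ₗ
      (TensorProduct.assoc k X.V Y.V Z.V).symm.toLinearMap ∘ₗ
        TensorProduct.mk k X.V _ (X.ract (op a) x))
    (g := LinearMap.rTensor Z.V (Hom.lin (π X Y)) ∘ₗ
      (TensorProduct.assoc k X.V Y.V Z.V).symm.toLinearMap ∘ₗ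
        TensorProduct.mk k X.V _ x ∘ₗ LinearMap.rTensor Z.V (Y.lact a))
    (TensorProduct.ext' fun y z => congrArg (fun u => u ⊗ₜ[k] z) (tmulA_bal x a y))
    (Hom.lin (ι Y Z) s)))

theorem π_distL (X Y Z : FDBimod k A) :
    π X (cotens Y Z) ≫ distL X Y Z = γL X Y Z ≫ mapC (π X Y) (𝟙 Z) := rfl

/-- The map `γ̃^l`, induced on `X ⊗_A (Y ⊗ₖ Z)` by `(π ⊗ₖ Z) ∘ α⁻¹`. -/
def γtL (X Y Z : FDBimod k A) : tensA X (tensK Y Z) ⟶ tensK (tensA X Y) Z :=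
  descA ((assocK X Y Z).inv ≫ mapK (π X Y) (𝟙 Z)) (fun x a t => LinearMap.congr_fun
    (f := LinearMap.rTensor Z.V (Hom.lin (π X Y)) ∘ₗ
      (TensorProduct.assoc k X.V Y.V Z.V).symm.toLinearMap ∘ₗ
        TensorProduct.mk k X.V _ (X.ract (op a) x))
    (g := LinearMap.rTensor Z.V (Hom.lin (π X Y)) ∘ₗ
      (TensorProduct.assoc k X.V Y.V Z.V).symm.toLinearMap ∘ₗ
        TensorProduct.mk k X.V _ x ∘ₗ LinearMap.rTensor Z.V (Y.lact a))
    (TensorProduct.ext' fun y z => congrArg (fun u => u ⊗ₜ[k] z) (tmulA_bal x a y)) t)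

theorem π_γtL (X Y Z : FDBimod k A) :
    π X (tensK Y Z) ≫ γtL X Y Z = (assocK X Y Z).inv ≫ mapK (π X Y) (𝟙 Z) := rfl

/-- The map `∂̃^l`, through which `γ̃^l ∘ (X ⊗_A ι)` factors. -/
def distTL (X Y Z : FDBimod k A) : tensA X (cotens Y Z) ⟶ cotens (tensA X Y) Z :=
  liftC (mapA (𝟙 X) (ι Y Z) ≫ γtL X Y Z) (fun t => by
    induction t using tensA_induction with
    | hadd s t hs ht => rw [map_add]; exact add_mem hs ht
    | h x s =>
      intro a
      have h₁ := LinearMap.congr_fun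
        (f := LinearMap.rTensor Z.V ((tensA X Y).ract (op a)) ∘ₗ
          LinearMap.rTensor Z.V (Hom.lin (π X Y)) ∘ₗ
          (TensorProduct.assoc k X.V Y.V Z.V).symm.toLinearMap ∘ₗ TensorProduct.mk k X.V _ x)
        (g := LinearMap.rTensor Z.V (Hom.lin (π X Y)) ∘ₗ
          (TensorProduct.assoc k X.V Y.V Z.V).symm.toLinearMap ∘ₗ TensorProduct.mk k X.V _ x ∘ₗ
          LinearMap.rTensor Z.V (Y.ract (op a)))
        (TensorProduct.ext' fun _ _ => rfl) (Hom.lin (ι Y Z) s)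
      have h₂ := LinearMap.congr_fun
        (f := LinearMap.lTensor (tensA X Y).V (Z.lact a) ∘ₗ
          LinearMap.rTensor Z.V (Hom.lin (π X Y)) ∘ₗ
          (TensorProduct.assoc k X.V Y.V Z.V).symm.toLinearMap ∘ₗ TensorProduct.mk k X.V _ x)
        (g := LinearMap.rTensor Z.V (Hom.lin (π X Y)) ∘ₗ
          (TensorProduct.assoc k X.V Y.V Z.V).symm.toLinearMap ∘ₗ TensorProduct.mk k X.V _ x ∘ₗ
          LinearMap.lTensor Y.V (Z.lact a))
        (TensorProduct.ext' fun _ _ => rfl) (Hom.lin (ι Y Z) s)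
      exact h₁.trans ((congrArg (fun u => LinearMap.rTensor Z.V (Hom.lin (π X Y))
        ((TensorProduct.assoc k X.V Y.V Z.V).symm (x ⊗ₜ[k] u))) (ι_mem s a)).trans h₂.symm))

theorem distTL_ι (X Y Z : FDBimod k A) :
    distTL X Y Z ≫ ι (tensA X Y) Z = mapA (𝟙 X) (ι Y Z) ≫ γtL X Y Z := rfl

/-- The map `γ^r`, through which `α ∘ (ι ⊗ₖ Z)` factors. -/
def γR (X Y Z : FDBimod k A) : tensK (cotens X Y) Z ⟶ cotens X (tensK Y Z) :=
  liftC (mapK (ι X Y) (𝟙 Z) ≫ (assocK X Y Z).hom) (fun t => by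
    induction t using TensorProduct.induction_on with
    | zero => exact ((cobal X (tensK Y Z)).comap
        (Hom.lin (mapK (ι X Y) (𝟙 Z) ≫ (assocK X Y Z).hom))).zero_mem
    | add s t hs ht => exact ((cobal X (tensK Y Z)).comap
        (Hom.lin (mapK (ι X Y) (𝟙 Z) ≫ (assocK X Y Z).hom))).add_mem hs ht
    | tmul s z =>
      intro a
      have h₁ := LinearMap.congr_fun
        (f := LinearMap.rTensor (Y.V ⊗[k] Z.V) (X.ract (op a)) ∘ₗ
          (TensorProduct.assoc k X.V Y.V Z.V).toLinearMap)
        (g := (TensorProduct.assoc k X.V Y.V Z.V).toLinearMap ∘ₗ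
          LinearMap.rTensor Z.V (LinearMap.rTensor Y.V (X.ract (op a))))
        (TensorProduct.ext_threefold fun _ _ _ => rfl) (Hom.lin (ι X Y) s ⊗ₜ[k] z)
      have h₂ := LinearMap.congr_fun
        (f := LinearMap.lTensor X.V (LinearMap.rTensor Z.V (Y.lact a)) ∘ₗ
          (TensorProduct.assoc k X.V Y.V Z.V).toLinearMap)
        (g := (TensorProduct.assoc k X.V Y.V Z.V).toLinearMap ∘ₗ
          LinearMap.rTensor Z.V (LinearMap.lTensor X.V (Y.lact a)))
        (TensorProduct.ext_threefold fun _ _ _ => rfl) (Hom.lin (ι X Y) s ⊗ₜ[k] z)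
      exact h₁.trans ((congrArg (fun u => TensorProduct.assoc k X.V Y.V Z.V (u ⊗ₜ[k] z))
        (ι_mem s a)).trans h₂.symm))

theorem γR_ι (X Y Z : FDBimod k A) :
    γR X Y Z ≫ ι X (tensK Y Z) = mapK (ι X Y) (𝟙 Z) ≫ (assocK X Y Z).hom := rfl

/-- The map `∂^r`, through which `(X ⊗^A π) ∘ γ^r` factors. -/
def distR (X Y Z : FDBimod k A) : tensA (cotens X Y) Z ⟶ cotens X (tensA Y Z) :=
  descA (γR X Y Z ≫ mapC (𝟙 X) (π Y Z)) (fun s a z => ι_injective _ _ (LinearMap.congr_fun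
    (f := LinearMap.lTensor X.V (Hom.lin (π Y Z)) ∘ₗ
      (TensorProduct.assoc k X.V Y.V Z.V).toLinearMap ∘ₗ
        (TensorProduct.mk k _ Z.V).flip z ∘ₗ LinearMap.lTensor X.V (Y.ract (op a)))
    (g := LinearMap.lTensor X.V (Hom.lin (π Y Z)) ∘ₗ
      (TensorProduct.assoc k X.V Y.V Z.V).toLinearMap ∘ₗ
        (TensorProduct.mk k _ Z.V).flip (Z.lact a z))
    (TensorProduct.ext' fun x y => congrArg (fun u => x ⊗ₜ[k] u) (tmulA_bal y a z))
    (Hom.lin (ι X Y) s)))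

theorem π_distR (X Y Z : FDBimod k A) :
    π (cotens X Y) Z ≫ distR X Y Z = γR X Y Z ≫ mapC (𝟙 X) (π Y Z) := rfl

/-- The map `γ̃^r`, induced on `(X ⊗ₖ Y) ⊗_A Z` by `(X ⊗ₖ π) ∘ α`. -/
def γtR (X Y Z : FDBimod k A) : tensA (tensK X Y) Z ⟶ tensK X (tensA Y Z) :=
  descA ((assocK X Y Z).hom ≫ mapK (𝟙 X) (π Y Z)) (fun t a z => LinearMap.congr_fun
    (f := LinearMap.lTensor X.V (Hom.lin (π Y Z)) ∘ₗ
      (TensorProduct.assoc k X.V Y.V Z.V).toLinearMap ∘ₗ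
        (TensorProduct.mk k _ Z.V).flip z ∘ₗ LinearMap.lTensor X.V (Y.ract (op a)))
    (g := LinearMap.lTensor X.V (Hom.lin (π Y Z)) ∘ₗ
      (TensorProduct.assoc k X.V Y.V Z.V).toLinearMap ∘ₗ
        (TensorProduct.mk k _ Z.V).flip (Z.lact a z))
    (TensorProduct.ext' fun x y => congrArg (fun u => x ⊗ₜ[k] u) (tmulA_bal y a z)) t)

theorem π_γtR (X Y Z : FDBimod k A) :
    π (tensK X Y) Z ≫ γtR X Y Z = (assocK X Y Z).hom ≫ mapK (𝟙 X) (π Y Z) := rfl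

/-- The map `∂̃^r`, through which `γ̃^r ∘ (ι ⊗_A Z)` factors. -/
def distTR (X Y Z : FDBimod k A) : tensA (cotens X Y) Z ⟶ cotens X (tensA Y Z) :=
  liftC (mapA (ι X Y) (𝟙 Z) ≫ γtR X Y Z) (fun t => by
    induction t using tensA_induction with
    | hadd s t hs ht => rw [map_add]; exact add_mem hs ht
    | h s z =>
      intro a
      have h₁ := LinearMap.congr_fun
        (f := LinearMap.rTensor (tensA Y Z).V (X.ract (op a)) ∘ₗ
          LinearMap.lTensor X.V (Hom.lin (π Y Z)) ∘ₗ
          (TensorProduct.assoc k X.V Y.V Z.V).toLinearMap ∘ₗ (TensorProduct.mk k _ Z.V).flip z)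
        (g := LinearMap.lTensor X.V (Hom.lin (π Y Z)) ∘ₗ
          (TensorProduct.assoc k X.V Y.V Z.V).toLinearMap ∘ₗ (TensorProduct.mk k _ Z.V).flip z ∘ₗ
          LinearMap.rTensor Y.V (X.ract (op a)))
        (TensorProduct.ext' fun _ _ => rfl) (Hom.lin (ι X Y) s)
      have h₂ := LinearMap.congr_fun
        (f := LinearMap.lTensor X.V ((tensA Y Z).lact a) ∘ₗ
          LinearMap.lTensor X.V (Hom.lin (π Y Z)) ∘ₗ
          (TensorProduct.assoc k X.V Y.V Z.V).toLinearMap ∘ₗ (TensorProduct.mk k _ Z.V).flip z)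
        (g := LinearMap.lTensor X.V (Hom.lin (π Y Z)) ∘ₗ
          (TensorProduct.assoc k X.V Y.V Z.V).toLinearMap ∘ₗ (TensorProduct.mk k _ Z.V).flip z ∘ₗ
          LinearMap.lTensor X.V (Y.lact a))
        (TensorProduct.ext' fun _ _ => rfl) (Hom.lin (ι X Y) s)
      exact h₁.trans ((congrArg (fun u => LinearMap.lTensor X.V (Hom.lin (π Y Z))
        (TensorProduct.assoc k X.V Y.V Z.V (u ⊗ₜ[k] z))) (ι_mem s a)).trans h₂.symm))

theorem distTR_ι (X Y Z : FDBimod k A) :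
    distTR X Y Z ≫ ι X (tensA Y Z) = mapA (ι X Y) (𝟙 Z) ≫ γtR X Y Z := rfl

/-! ### The abstract distributors -/

variable [Module.Finite k A]

/-- The module functor structure of `- ⊗_A Z` given by the associator of `⊗_A`. -/
@[reducible] def tensorRightOplax (Z : FDBimod k A) :
    (tensorRight Z).OplaxLeftLinear (FDBimod k A) where
  δₗ c d := (α_ c d Z).hom
  δₗ_naturality_left f d := associator_naturality_left f d Z
  δₗ_naturality_right c _ _ f := associator_naturality_middle c f Z
  δₗ_associativity c c' d := (pentagon c c' d Z).symm
  δₗ_unitality_inv d := by simp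

/-- The right module functor structure of `Z ⊗_A -` given by the associator of `⊗_A`. -/
@[reducible] def tensorLeftOplax (Z : FDBimod k A) :
    (tensorLeft Z).OplaxRightLinear (FDBimod k A) where
  δᵣ d c := (α_ Z d c).inv
  δᵣ_naturality_right d _ _ f := associator_inv_naturality_right Z d f
  δᵣ_naturality_left f c := associator_inv_naturality_middle Z f c
  δᵣ_associativity d c c' := by simp
  δᵣ_unitality_inv d := by simp

/-- The module functor structure of `iHom^r(Z, -) = - ⊗^A Z^*` over the bimodules with `⊗^A`,
given by the associator of `⊗^A`. -/
@[reducible] def iHomRLax (Z : FDBimod k A) : (iHomR Z).LaxLeftLinear (CoBimod k A) where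
  μₗ c d := (assocC (k := k) (A := A) c d Z.dual).inv
  μₗ_naturality_left f d :=
    associator_inv_naturality_left (C := CoBimod k A) f d Z.dual
  μₗ_naturality_right c _ _ f :=
    associator_inv_naturality_middle (C := CoBimod k A) c f Z.dual
  μₗ_associativity c c' d := pentagon_inv_hom (C := CoBimod k A) c c' d Z.dual
  μₗ_unitality d := leftUnitor_tensor_hom (C := CoBimod k A) d Z.dual

/-- The lax module functor structure of `iHom^r(Z, -)` over the bimodules with `⊗_A`. -/
@[reducible] def iHomRLaxA (Z : FDBimod k A) : (iHomR Z).LaxLeftLinear (FDBimod k A) :=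
  letI := tensorRightOplax Z
  laxLeftOfAdj (adjR Z)

/-- The lax right module functor structure of `iHom^l(Z, -)` over the bimodules with `⊗_A`. -/
@[reducible] def iHomLLaxA (Z : FDBimod k A) : (iHomL Z).LaxRightLinear (FDBimod k A) :=
  letI := tensorLeftOplax Z
  laxRightOfAdj (adjL Z)

/-- The oplax module functor structure of `- ⊗_A Z` over the bimodules with `⊗^A`. -/
@[reducible] def tensorRightOplaxC (Z : FDBimod k A) :
    (tensorRight Z).OplaxLeftLinear (CoBimod k A) :=
  letI := iHomRLax Z
  oplaxLeftOfAdj (adjR Z)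

/-- `X ⊗_A iHom^r(Z, Y) ⟶ iHom^r(Z, X ⊗_A Y)`, the lax module structure of `iHom^r(Z, -)`. -/
def δR (Z X Y : FDBimod k A) : tensA X (cotens Y Z.dual) ⟶ cotens (tensA X Y) Z.dual :=
  (iHomRLaxA Z).μₗ X Y

/-- `iHom^l(Z, X) ⊗_A Y ⟶ iHom^l(Z, X ⊗_A Y)`, the lax module structure of `iHom^l(Z, -)`. -/
def δL (Z X Y : FDBimod k A) : tensA (cotens Z.dual X) Y ⟶ cotens Z.dual (tensA X Y) :=
  (iHomLLaxA Z).μᵣ X Y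

/-- `(Z^* ⊗^A X) ⊗_A Y ⟶ Z^* ⊗^A (X ⊗_A Y)`, the oplax module structure of `- ⊗_A Y` over the
bimodules with `⊗^A`. -/
def δLop (Z X Y : FDBimod k A) : tensA (cotens Z.dual X) Y ⟶ cotens Z.dual (tensA X Y) :=
  (tensorRightOplaxC Y).δₗ (show CoBimod k A from Z.dual) X

end Distributors
end FDBimod
end

namespace FDBimod

section Compare

variable {k A : Type u} [Field k] [Ring A] [Algebra k A]

/-! ### Element formulas and naturality of the distributors -/

/-! All the maps in the theorem rebracket tensors without changing them, so the proof reduces each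
one to a single element formula. Two facts make this enough. The source `tensA (cotens X Y) Z` is
spanned by the classes `tmulA s z`, and `ι` embeds the target into `X ⊗ₖ (Y ⊗_A Z)`. A homomorphism
is therefore known once `ι` of its value on every `tmulA s z` is known.

For `distR` that value is the image of `ι s` under the linear map `id ⊗ [- ⊗ z]`, and for `distL` it
is the image of `ι s` under `[x ⊗ -] ⊗ id` (`ι_distR_tmulA`, `ι_distL_tmulA`). Elements of an
equalizer tensor product are sums whose single terms need not lie in it, so the formulas are written
as linear maps applied to `ι s`, which makes sense on the full tensor product over `k`. The formulas
on explicit sums are special cases. The tilde versions have the same values by definition: taking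
the quotient before or after restricting to the equalizer yields the same element.

For the internal Homs, read an element of `Z^* ⊗ₖ X` as a linear map from `Z` to `X`. Then `id ⊗ [-
⊗ y]` is postcomposition with `[- ⊗ y]` (`evL_lTensor`; on the other side, `evR_rTensor`). The
transpose of the lax structure under the adjunction is the associator followed by the counit, and
the counit is evaluation. So both transposes send `[z ⊗ [s ⊗ y]]` to `[s(z) ⊗ y]`, and the lax
structure is `distR` (`δL_eq_distR`). The mirror image of this argument gives `δR_eq_distL`.

The oplax structure comes from the other direction: it is the transpose of the unit, which sends `x`
to `[x ⊗ -]`, followed by the inverse associator of `⊗^A`. Inside the triple tensor product over `k`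
that associator becomes invisible, and evaluating the last factor at `y` turns `[x ⊗ -]` into `[x ⊗
y]`. This is again `id ⊗ [- ⊗ y]` (`ι_evR_ι`, `δLop_eq_distR`).

These comparisons concern distributors with a dual in the outer position. Taking the dual of `X` or
of `Z` there produces a double dual, and naturality in that variable carries the result back along
`bidual` (`distR_conj_iso`, `distL_conj_iso`). -/

theorem ι_distR_tmulA {X Y Z : FDBimod k A} (s : (cotens X Y).V) (z : Z.V) :
    Hom.lin (ι X (tensA Y Z)) (Hom.lin (distR X Y Z) (tmulA s z)) =
      LinearMap.lTensor X.V ((mkA Y Z).flip z) (Hom.lin (ι X Y) s) :=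
  LinearMap.congr_fun
    (f := LinearMap.lTensor X.V (Hom.lin (π Y Z)) ∘ₗ
      (TensorProduct.assoc k X.V Y.V Z.V).toLinearMap ∘ₗ (TensorProduct.mk k _ Z.V).flip z)
    (g := LinearMap.lTensor X.V ((mkA Y Z).flip z))
    -- Since `s` is not a pure tensor in general, the two sides are compared as linear maps on all
    -- of `X ⊗ₖ Y`, where pure tensors suffice, and only then evaluated at `ι s`. Most of the later
    -- computations follow this pattern.
    (TensorProduct.ext' fun _ _ => rfl) (Hom.lin (ι X Y) s)

theorem ι_distL_tmulA {X Y Z : FDBimod k A} (x : X.V) (s : (cotens Y Z).V) :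
    Hom.lin (ι (tensA X Y) Z) (Hom.lin (distL X Y Z) (tmulA x s)) =
      LinearMap.rTensor Z.V (mkA X Y x) (Hom.lin (ι Y Z) s) :=
  LinearMap.congr_fun
    (f := LinearMap.rTensor Z.V (Hom.lin (π X Y)) ∘ₗ
      (TensorProduct.assoc k X.V Y.V Z.V).symm.toLinearMap ∘ₗ TensorProduct.mk k X.V _ x)
    (g := LinearMap.rTensor Z.V (mkA X Y x))
    (TensorProduct.ext' fun _ _ => rfl) (Hom.lin (ι Y Z) s)

/-- On `[s ⊗ z]` both constructions produce the vector `(X ⊗ π)(α(ι s ⊗ z))`. They differ only in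
whether membership in the equalizer is established before or after passing to the quotient, and a
proof of membership does not affect the element. -/
theorem distR_eq_distTR (X Y Z : FDBimod k A) : distR X Y Z = distTR X Y Z :=
  tensA_hom_ext fun _ _ => rfl

theorem distL_eq_distTL (X Y Z : FDBimod k A) : distL X Y Z = distTL X Y Z :=
  tensA_hom_ext fun _ _ => rfl

/-- After `ι`, the morphism `f` acts on the first tensor factor and the distributor acts on the
second one as `[- ⊗ z]`, so the two operations commute. Only naturality in the outer variable is
needed, because that is where the double dual appears. -/
theorem distR_naturality_left {X X' : FDBimod k A} (f : X ⟶ X') (Y Z : FDBimod k A) :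
    mapA (mapC f (𝟙 Y)) (𝟙 Z) ≫ distR X' Y Z = distR X Y Z ≫ mapC f (𝟙 (tensA Y Z)) :=
  tensA_hom_ext fun s z => ι_injective _ _ <| by
    refine (ι_distR_tmulA (Hom.lin (mapC f (𝟙 Y)) s) z).trans ?_
    refine Eq.trans ?_
      (congrArg (TensorProduct.map (Hom.lin f) LinearMap.id) (ι_distR_tmulA s z)).symm
    exact LinearMap.congr_fun
      (f := LinearMap.lTensor X'.V ((mkA Y Z).flip z) ∘ₗ
        TensorProduct.map (Hom.lin f) LinearMap.id)
      (g := TensorProduct.map (Hom.lin f) LinearMap.id ∘ₗ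
        LinearMap.lTensor X.V ((mkA Y Z).flip z))
      (TensorProduct.ext' fun _ _ => rfl) (Hom.lin (ι X Y) s)

theorem distL_naturality_right (X Y : FDBimod k A) {Z Z' : FDBimod k A} (f : Z ⟶ Z') :
    mapA (𝟙 X) (mapC (𝟙 Y) f) ≫ distL X Y Z' = distL X Y Z ≫ mapC (𝟙 (tensA X Y)) f :=
  tensA_hom_ext fun x s => ι_injective _ _ <| by
    refine (ι_distL_tmulA x (Hom.lin (mapC (𝟙 Y) f) s)).trans ?_
    refine Eq.trans ?_
      (congrArg (TensorProduct.map LinearMap.id (Hom.lin f)) (ι_distL_tmulA x s)).symm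
    exact LinearMap.congr_fun
      (f := LinearMap.rTensor Z'.V (mkA X Y x) ∘ₗ
        TensorProduct.map LinearMap.id (Hom.lin f))
      (g := TensorProduct.map LinearMap.id (Hom.lin f) ∘ₗ
        LinearMap.rTensor Z.V (mkA X Y x))
      (TensorProduct.ext' fun _ _ => rfl) (Hom.lin (ι Y Z) s)

/-- Naturality slides `e.hom` past the distributor, where it cancels against `e.inv`. This is what
gives the identification of `X` with its double dual a precise meaning in the final statement. -/
theorem distR_conj_iso {X X' : FDBimod k A} (e : X ≅ X') (Y Z : FDBimod k A) :
    mapA (mapC e.hom (𝟙 Y)) (𝟙 Z) ≫ distR X' Y Z ≫ mapC e.inv (𝟙 (tensA Y Z)) =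
      distR X Y Z := by
  rw [← Category.assoc, distR_naturality_left, Category.assoc, ← mapC_comp, e.hom_inv_id,
    Category.comp_id, mapC_id, Category.comp_id]

theorem distL_conj_iso (X Y : FDBimod k A) {Z Z' : FDBimod k A} (e : Z ≅ Z') :
    mapA (𝟙 X) (mapC (𝟙 Y) e.hom) ≫ distL X Y Z' ≫ mapC (𝟙 (tensA X Y)) e.inv =
      distL X Y Z := by
  rw [← Category.assoc, distL_naturality_right, Category.assoc, ← mapC_comp, e.hom_inv_id,
    Category.comp_id, mapC_id, Category.comp_id]

/-! ### Comparison with the module functor structures -/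

/-- Evaluating an element of `(V ⊗^A W) ⊗^A Y^*` at `y` gives an element of `V ⊗^A W`, whose
image in `V ⊗ₖ W` is obtained by evaluating the last two tensor factors. -/
theorem ι_evR_ι {V W Y : FDBimod k A} (t : (cotens (cotens V W) Y.dual).V) (y : Y.V) :
    Hom.lin (ι V W) (evR Y (cotens V W) (Hom.lin (ι (cotens V W) Y.dual) t) y) =
      LinearMap.lTensor V.V (LinearMap.applyₗ y ∘ₗ (evR Y W).toLinearMap)
        (Hom.lin (ιl V W Y.dual) t) :=
  LinearMap.congr_fun
    (f := Hom.lin (ι V W) ∘ₗ LinearMap.applyₗ y ∘ₗ (evR Y (cotens V W)).toLinearMap)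
    (g := LinearMap.lTensor V.V (LinearMap.applyₗ y ∘ₗ (evR Y W).toLinearMap) ∘ₗ
      (TensorProduct.assoc k V.V W.V (Module.Dual k Y.V)).toLinearMap ∘ₗ
        LinearMap.rTensor (Module.Dual k Y.V) (Hom.lin (ι V W)))
    (TensorProduct.ext' fun s (f : Module.Dual k Y.V) =>
      LinearMap.congr_fun
        (f := f y • Hom.lin (ι V W))
        (g := LinearMap.lTensor V.V (LinearMap.applyₗ y ∘ₗ (evR Y W).toLinearMap) ∘ₗ
          (TensorProduct.assoc k V.V W.V (Module.Dual k Y.V)).toLinearMap ∘ₗ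
          (TensorProduct.mk k _ (Module.Dual k Y.V)).flip f ∘ₗ Hom.lin (ι V W))
        -- Here `f` is fixed and `s` still ranges over the equalizer, where pure tensors are not
        -- available. Both sides depend on `s` only through `ι s`, so the identity is extended to `V
        -- ⊗ₖ W`; on `v ⊗ w` it says that the scalar `f y` may be moved onto `w`.
        (LinearMap.ext fun s => LinearMap.congr_fun
          (f := f y • LinearMap.id)
          (g := LinearMap.lTensor V.V (LinearMap.applyₗ y ∘ₗ (evR Y W).toLinearMap) ∘ₗ
            (TensorProduct.assoc k V.V W.V (Module.Dual k Y.V)).toLinearMap ∘ₗ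
            (TensorProduct.mk k _ (Module.Dual k Y.V)).flip f)
          (TensorProduct.ext' fun v w => (TensorProduct.tmul_smul (f y) v w).symm)
          (Hom.lin (ι V W) s)) s)
    (Hom.lin (ι (cotens V W) Y.dual) t)

/-- In contrast to `evL_map`, the map `g` is only `k`-linear. This generality is needed because `[-
⊗ y]`, to which it is applied, does not respect the right action in general. -/
theorem evL_lTensor {Z Y W : FDBimod k A} (g : Y.V →ₗ[k] W.V) (t : (tensK Z.dual Y).V) (z : Z.V) :
    evL Z W (LinearMap.lTensor Z.dual.V g t) z = g (evL Z Y t z) :=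
  LinearMap.congr_fun
    (f := LinearMap.applyₗ z ∘ₗ (evL Z W).toLinearMap ∘ₗ LinearMap.lTensor Z.dual.V g)
    (g := g ∘ₗ LinearMap.applyₗ z ∘ₗ (evL Z Y).toLinearMap)
    (TensorProduct.ext' fun (f : Module.Dual k Z.V) y => (map_smul g (f z) y).symm) t

theorem evR_rTensor {Z Y W : FDBimod k A} (g : Y.V →ₗ[k] W.V) (t : (tensK Y Z.dual).V) (z : Z.V) :
    evR Z W (LinearMap.rTensor Z.dual.V g t) z = g (evR Z Y t z) :=
  LinearMap.congr_fun
    (f := LinearMap.applyₗ z ∘ₗ (evR Z W).toLinearMap ∘ₗ LinearMap.rTensor Z.dual.V g)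
    (g := g ∘ₗ LinearMap.applyₗ z ∘ₗ (evR Z Y).toLinearMap)
    (TensorProduct.ext' fun y (f : Module.Dual k Z.V) => (map_smul g (f z) y).symm) t

/-! ### Transposition across the internal Hom adjunctions -/

variable [Module.Finite k A]

/-- The transported module structures are expressed through the hom bijection of the adjunction.
Replacing it by the explicit one makes transposes computable on elements. -/
theorem adjL_homEquiv (Z X Y : FDBimod k A) : (adjL Z).homEquiv X Y = homEquivL Z X Y :=
  congrFun (congrFun (Adjunction.mkOfHomEquiv_homEquiv _) X) Y

theorem adjR_homEquiv (Z X Y : FDBimod k A) : (adjR Z).homEquiv X Y = homEquivR Z X Y :=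
  congrFun (congrFun (Adjunction.mkOfHomEquiv_homEquiv _) X) Y

theorem δL_eq_distR (Z X Y : FDBimod k A) : δL Z X Y = distR Z.dual X Y := by
  refine (congrFun (congrArg DFunLike.coe (adjL_homEquiv Z _ _)) _).trans ?_
  -- The comparison is made on the untransposed side, between maps out of `Z ⊗_A ((Z^* ⊗^A X) ⊗_A
  -- Y)`. There the inverse associator followed by the counit sends `[z ⊗ [s ⊗ y]]` to `[s(z) ⊗ y]`,
  -- with `s` read as a linear map.
  refine (Equiv.eq_symm_apply _).1 (hom_ext (tensA_ext₃' fun z s y => ?_))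
  refine Eq.trans ?_ (congrArg (fun t => evL Z (tensA X Y) t z) (ι_distR_tmulA s y)).symm
  exact (evL_lTensor ((mkA X Y).flip y) (Hom.lin (ι Z.dual X) s) z).symm

theorem δR_eq_distL (Z X Y : FDBimod k A) : δR Z X Y = distL X Y Z.dual := by
  refine (congrFun (congrArg DFunLike.coe (adjR_homEquiv Z _ _)) _).trans ?_
  -- Untransposed, the lax structure is the associator followed by the counit in the second factor,
  -- so it sends `[[x ⊗ s] ⊗ z]` to `[x ⊗ s(z)]`.
  refine (Equiv.eq_symm_apply _).1 (hom_ext (tensA_ext₃ fun x s z => ?_))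
  refine Eq.trans ?_ (congrArg (fun t => evR Z (tensA X Y) t z) (ι_distL_tmulA x s)).symm
  exact (evR_rTensor (mkA X Y x) (Hom.lin (ι Y Z.dual) s) z).symm

/-- Undoing the transpose means evaluating at `y`. Applied to the unit followed by the inverse
associator of `⊗^A`, this evaluation cancels the coevaluation hidden in the unit and leaves `id ⊗ [-
⊗ y]`. -/
theorem δLop_eq_distR (Z X Y : FDBimod k A) : δLop Z X Y = distR Z.dual X Y := by
  refine (congrFun (congrArg (fun e => DFunLike.coe (Equiv.symm e))
    (adjR_homEquiv Y (cotens Z.dual X) (cotens Z.dual (tensA X Y)))) _).trans ?_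
  refine tensA_hom_ext fun s y => ι_injective _ _ ?_
  refine Eq.trans ?_ (ι_distR_tmulA s y).symm
  -- This is the unit of the adjunction at `X`: the transpose of the identity, sending `x` to the
  -- linear map `[x ⊗ -]`.
  let u : X ⟶ cotens (tensA X Y) Y.dual := homEquivR Y X (tensA X Y) (𝟙 _)
  refine (ι_evR_ι (Hom.lin (mapC (𝟙 Z.dual) u ≫ (assocC Z.dual (tensA X Y) Y.dual).inv) s)
    y).trans ?_
  -- The associator of `⊗^A` has no formula on elements. It is characterised by matching the
  -- inclusions `ιl` and `ιr` of the two bracketings into the triple tensor product over `k`, so it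
  -- disappears after composing with `ιl`.
  have h : (mapC (𝟙 Z.dual) u ≫ (assocC Z.dual (tensA X Y) Y.dual).inv) ≫ ιl _ _ _ =
      ι Z.dual X ≫ mapK (𝟙 Z.dual) (u ≫ ι _ _) := by
    rw [← assocC_hom_ιr, Category.assoc, Iso.inv_hom_id_assoc, ιr, ← Category.assoc, mapC_ι,
      Category.assoc, mapK_comp, Category.comp_id]
  refine (congrArg _ (LinearMap.congr_fun (congrArg Hom.lin h) s)).trans ?_
  exact LinearMap.congr_fun
    (f := LinearMap.lTensor Z.dual.V (LinearMap.applyₗ y ∘ₗ (evR Y (tensA X Y)).toLinearMap) ∘ₗ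
      LinearMap.lTensor Z.dual.V (Hom.lin (u ≫ ι _ _)))
    (g := LinearMap.lTensor Z.dual.V ((mkA X Y).flip y))
    -- Evaluating `u x` at `y` gives `[x ⊗ y]`, since `evR` inverts the passage from linear maps to
    -- tensors used to define `u`.
    (TensorProduct.ext' fun f x => congrArg (fun w => f ⊗ₜ[k] w)
      (LinearMap.congr_fun ((evR Y (tensA X Y)).apply_symm_apply (mkA X Y x)) y))
    (Hom.lin (ι Z.dual X) s)

end Compare
end FDBimod

/-! ### Assembly of the comparisons and the formulas on explicit sums -/

/-- Let `A` be a finite-dimensional algebra over a field `k`, and let `X`, `Y`, `Z` be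
finite-dimensional `(A,A)`-bimodules. The maps `∂^r` and `∂̃^r` agree with each other and, under
`X ≅ X^**`, with the distributor given by the internal Hom `iHom^l(X^*, -)` (in both ways of
defining it), the maps `∂^l` and `∂̃^l` agree with each other and, under `Z ≅ Z^**`, with the
distributor given by the internal Hom `iHom^r(Z^*, -)`, and they are given by the expected
formulas on elements. -/
theorem mainTheorem4 {k A : Type u} [Field k] [Ring A] [Algebra k A] [Module.Finite k A]
    (X Y Z : FDBimod k A) :
    (FDBimod.distR X Y Z =
        FDBimod.mapA (FDBimod.mapC (FDBimod.bidual X).hom (𝟙 Y)) (𝟙 Z) ≫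
          FDBimod.δL X.dual Y Z ≫
            FDBimod.mapC (FDBimod.bidual X).inv (𝟙 (FDBimod.tensA Y Z)) ∧
      FDBimod.distR X Y Z =
        FDBimod.mapA (FDBimod.mapC (FDBimod.bidual X).hom (𝟙 Y)) (𝟙 Z) ≫
          FDBimod.δLop X.dual Y Z ≫
            FDBimod.mapC (FDBimod.bidual X).inv (𝟙 (FDBimod.tensA Y Z)) ∧
      FDBimod.distR X Y Z = FDBimod.distTR X Y Z) ∧
    (FDBimod.distL X Y Z =
        FDBimod.mapA (𝟙 X) (FDBimod.mapC (𝟙 Y) (FDBimod.bidual Z).hom) ≫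
          FDBimod.δR Z.dual X Y ≫
            FDBimod.mapC (𝟙 (FDBimod.tensA X Y)) (FDBimod.bidual Z).inv ∧
      FDBimod.distL X Y Z = FDBimod.distTL X Y Z) ∧
    (∀ (n : ℕ) (x : Fin n → X.V) (y : Fin n → Y.V)
        (h : ∑ i, x i ⊗ₜ[k] y i ∈ FDBimod.cobal X Y) (z : Z.V),
      FDBimod.Hom.lin (FDBimod.ι X (FDBimod.tensA Y Z))
          (FDBimod.Hom.lin (FDBimod.distR X Y Z)
            (FDBimod.tmulA (X := FDBimod.cotens X Y) ⟨∑ i, x i ⊗ₜ[k] y i, h⟩ z)) =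
        ∑ i, x i ⊗ₜ[k] FDBimod.tmulA (y i) z) ∧
    (∀ (n : ℕ) (x : X.V) (y : Fin n → Y.V) (z : Fin n → Z.V)
        (h : ∑ j, y j ⊗ₜ[k] z j ∈ FDBimod.cobal Y Z),
      FDBimod.Hom.lin (FDBimod.ι (FDBimod.tensA X Y) Z)
          (FDBimod.Hom.lin (FDBimod.distL X Y Z)
            (FDBimod.tmulA (Y := FDBimod.cotens Y Z) x ⟨∑ j, y j ⊗ₜ[k] z j, h⟩)) =
        ∑ j, FDBimod.tmulA x (y j) ⊗ₜ[k] z j) := by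
  refine ⟨⟨?_, ?_, FDBimod.distR_eq_distTR X Y Z⟩, ⟨?_, FDBimod.distL_eq_distTL X Y Z⟩,
    fun n x y h z => ?_, fun n x y z h => ?_⟩
  -- The comparison with `X.dual` in place of `Z` yields the distributor at `X.dual.dual`;
  -- conjugating by `bidual` brings it back to `X`.
  · rw [FDBimod.δL_eq_distR]
    exact (FDBimod.distR_conj_iso (FDBimod.bidual X) Y Z).symm
  · rw [FDBimod.δLop_eq_distR]
    exact (FDBimod.distR_conj_iso (FDBimod.bidual X) Y Z).symm
  · rw [FDBimod.δR_eq_distL]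
    exact (FDBimod.distL_conj_iso X Y (FDBimod.bidual Z)).symm
  -- The inclusion `ι` forgets the membership proof, so the element formula applies to the bare sum
  -- and linearity distributes it over the terms, although these need not lie in the equalizer
  -- individually.
  · exact (FDBimod.ι_distR_tmulA _ z).trans
      (map_sum (LinearMap.lTensor X.V ((FDBimod.mkA Y Z).flip z))
        (fun i => x i ⊗ₜ[k] y i) Finset.univ)
  · exact (FDBimod.ι_distL_tmulA x _).trans
      (map_sum (LinearMap.rTensor Z.V (FDBimod.mkA X Y x))
        (fun j => y j ⊗ₜ[k] z j) Finset.univ)
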